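/- Let $\ell$ be Lebesgue measure on $\mathbb R^d$, let $C_R$ be the open cube of edge length $R$ about $0$ in $\mathbb R^d$, and let $\mathbb E=\mathbb R^d\times\{1,\dots,m\}$ be the space of coloured points, on which $\mathbb R^d$ acts by $t+(x,i)=(t+x,i)$. For $\varLambda\subset\mathbb E$ and $B\subset\mathbb R^d$ put $B+\varLambda=\bigcup_{b\in B}(b+\varLambda)$ and $\varLambda^{\downarrow}=\{x:(x,i)\in\varLambda\text{ for some }i\}$. A set $\varLambda\subset\mathbb E$ is $r$-uniformly discrete if every translate $a+C_r$, $a\in\mathbb R^d$, contains at most one point of $\varLambda$, all colours taken together. Let $M_p$ be the space of point measures on $\mathbb E$ (Borel measures with values in $\mathbb N$ on relatively compact Borel sets), with the vague topology and its Borel $\sigma$-algebra. Let $r>0$ and let $\mu$ be the law of an $m$-coloured $r$-uniformly discrete stationary ergodic point process, that is, a Borel probability measure on $M_p$ that is invariant and ergodic under the translations by $\mathbb R^d$ and whose support $X$ consists of point measures giving mass at most $1$ to each $(a+C_r)\times\{1,\dots,m\}$, $a\in\mathbb R^d$. Elements of $X$ are identified with their point sets $\varLambda\subset\mathbb E$.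 The Palm measure of $\mu$ is $$\dot\mu(D)=\frac1{\ell(B)}\int_X\sum_{x\in B\cap\varLambda^{\downarrow}}\mathbf 1_D(-x+\varLambda)\,d\mu(\varLambda)$$ for Borel sets $D\subset X$, where $B\subset\mathbb R^d$ is any bounded Borel set with $\ell(B)>0$ (the value does not depend on $B$). A pattern is a pair $(F,V)$ where $F\subset\mathbb E$ is a finite $r$-uniformly discrete set with $0\in F^{\downarrow}$ and $V\subset\mathbb R^d$ is a bounded measurable neighbourhood of $0$. Put $$X_{F,V}=\{\varLambda\in X: F\subset V+\varLambda\},$$ $$L_{F,V}(\varLambda,B)=\operatorname{card}\{x\in\varLambda^{\downarrow}: F\subset -x+V+\varLambda,\ x-V+F^{\downarrow}\subset B\}.$$ Proposition 11.1. Let $(F,V)$ be a pattern. If $V$ is open, then $$\liminf_{R\to\infty}\frac{1}{\ell(C_R)}L_{F,V}(\varLambda,C_R)=\dot\mu(X_{F,V})\quad\text{for }\mu\text{-almost every }\varLambda\in X.$$ If $V$ is closed, then $$\limsup_{R\to\infty}\frac{1}{\ell(C_R)}L_{F,V}(\varLambda,C_R)=\dot\mu(X_{F,V})\quad\text{for }\mu\text{-almost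 every }\varLambda\in X.$$ -/

import Mathlib

open MeasureTheory Filter Topology Set
open scoped ENNReal

/-- The space `ℝ^d × {1, …, m}` of coloured points: `(x, i)` is the point `x` with colour `i`.
Only the topology, the bounded sets and the Lebesgue measure of `ℝ^d` are used below, so it does
not matter that the type `Fin d → ℝ` carries the sup norm. -/
abbrev ColSpace (d m : ℕ) : Type := (Fin d → ℝ) × Fin m

/-- The open cube `C_R` of edge length `R` about `0` in `ℝ^d`. -/
def openCube (d : ℕ) (R : ℝ) : Set (Fin d → ℝ) := {x | ∀ i, |x i| < R / 2}

/-- Translation `(x, i) ↦ (t + x, i)` of coloured points. -/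
def shift {d m : ℕ} (t : Fin d → ℝ) (z : ColSpace d m) : ColSpace d m := (t + z.1, z.2)

/-- The flattening `Λ^↓` of a coloured set. -/
def flatten {d m : ℕ} (Λ : Set (ColSpace d m)) : Set (Fin d → ℝ) := Prod.fst '' Λ

/-- The coloured set `B + Λ = ⋃_{b ∈ B} (b + Λ)`. -/
def setShift {d m : ℕ} (B : Set (Fin d → ℝ)) (Λ : Set (ColSpace d m)) : Set (ColSpace d m) :=
  ⋃ b ∈ B, shift b '' Λ

/-- `r`-uniformly discrete coloured sets: every translate `a + C_r` contains at most one
point of `Λ`, all colours taken together. -/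
def IsUniformlyDiscrete {d m : ℕ} (r : ℝ) (Λ : Set (ColSpace d m)) : Prop :=
  ∀ a : Fin d → ℝ, {z ∈ Λ | z.1 - a ∈ openCube d r}.encard ≤ 1

/-- Point measures on the space of coloured points: Borel measures whose values on relatively
compact Borel sets are natural numbers. -/
structure PointMeasure (d m : ℕ) where
  toMeasure : Measure (ColSpace d m)
  nat_valued : ∀ A : Set (ColSpace d m), MeasurableSet A → IsCompact (closure A) →
    ∃ n : ℕ, toMeasure A = n

namespace PointMeasure

variable {d m : ℕ}

/-- The vague topology: the coarsest one for which all `ξ ↦ ∫ f dξ` with `f` continuous and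
compactly supported are continuous. -/
noncomputable instance : TopologicalSpace (PointMeasure d m) :=
  TopologicalSpace.induced
    (fun (ξ : PointMeasure d m) (f : CompactlySupportedContinuousMap (ColSpace d m) ℝ) =>
      ∫ z, f z ∂ξ.toMeasure) inferInstance

/-- The Borel σ-algebra of the vague topology. -/
noncomputable instance : MeasurableSpace (PointMeasure d m) := borel _

instance : BorelSpace (PointMeasure d m) := ⟨rfl⟩

/-- The set of atoms of a point measure, that is, its point set. -/
def points (ξ : PointMeasure d m) : Set (ColSpace d m) := {z | ξ.toMeasure {z} ≠ 0}

theorem measurable_shift (t : Fin d → ℝ) : Measurable (shift (m := m) t) :=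
  (measurable_fst.const_add t).prodMk measurable_snd

/-- The translate `T_t ξ`, with `(T_t ξ)(A) = ξ(-t + A)`; its point set is `t + Λ`. -/
noncomputable def translate (t : Fin d → ℝ) (ξ : PointMeasure d m) : PointMeasure d m where
  toMeasure := ξ.toMeasure.map (shift t)
  nat_valued := by
    intro A hA hc
    rw [Measure.map_apply (measurable_shift t) hA]
    refine ξ.nat_valued _ (measurable_shift t hA) ?_
    have hcont : Continuous (shift (m := m) (-t)) := by unfold shift; fun_prop
    refine (hc.image hcont).of_isClosed_subset isClosed_closure ?_
    refine closure_minimal ?_ (hc.image hcont).isClosed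
    intro z hz
    exact ⟨shift t z, subset_closure hz, by simp [shift]⟩

noncomputable instance : VAdd (Fin d → ℝ) (PointMeasure d m) := ⟨translate⟩

end PointMeasure

/-- The set of point measures that give mass at most `1` to each translate `a + C_r` of the open
cube, all colours taken together. -/
def hardCore (d m : ℕ) (r : ℝ) : Set (PointMeasure d m) :=
  {ξ | ∀ a : Fin d → ℝ, ξ.toMeasure {z | z.1 - a ∈ openCube d r} ≤ 1}

/-- `μ` is the law of an `m`-coloured uniformly discrete stationary ergodic point process on
`ℝ^d` with discreteness constant `r`. (`ErgodicVAdd` contains the invariance of `μ` under all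
translations.) -/
structure IsUDErgodicLaw {d m : ℕ} (r : ℝ) (μ : Measure (PointMeasure d m)) : Prop where
  isProbabilityMeasure : IsProbabilityMeasure μ
  pos : 0 < r
  support_subset : μ.support ⊆ hardCore d m r
  ergodic : ErgodicVAdd (Fin d → ℝ) (PointMeasure d m) μ

/-- A pattern `(F, V)`: `F` is a finite `r`-uniformly discrete coloured set with a point at `0`,
and `V` is a bounded measurable neighbourhood of `0`. -/
structure IsPattern {d m : ℕ} (r : ℝ) (F : Set (ColSpace d m)) (V : Set (Fin d → ℝ)) : Prop where
  finite : F.Finite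
  uniformlyDiscrete : IsUniformlyDiscrete r F
  zero_mem : 0 ∈ flatten F
  bounded : Bornology.IsBounded V
  measurable : MeasurableSet V
  nhds_zero : V ∈ 𝓝 0

/-- The set `X_{F,V}` of those `Λ ∈ X` with `F ⊆ V + Λ`, where `X` is the support of `μ`. -/
def patternSet {d m : ℕ} (μ : Measure (PointMeasure d m)) (F : Set (ColSpace d m))
    (V : Set (Fin d → ℝ)) : Set (PointMeasure d m) :=
  {ξ ∈ μ.support | F ⊆ setShift V ξ.points}

/-- The number `L_{F,V}(Λ, B)` of the points `x ∈ Λ^↓` with `F ⊆ -x + V + Λ` and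
`x - V + F ⊆ B` (positions only). -/
noncomputable def patternCount {d m : ℕ} (F : Set (ColSpace d m)) (V : Set (Fin d → ℝ))
    (Λ : Set (ColSpace d m)) (B : Set (Fin d → ℝ)) : ℕ∞ :=
  {x ∈ flatten Λ | F ⊆ shift (-x) '' setShift V Λ ∧
    ∀ v ∈ V, ∀ f ∈ flatten F, x - v + f ∈ B}.encard

/-- The normalized count `L_{F,V}(Λ, C_R) / ℓ(C_R)`. -/
noncomputable def patternDensity {d m : ℕ} (F : Set (ColSpace d m)) (V : Set (Fin d → ℝ))
    (Λ : Set (ColSpace d m)) (R : ℝ) : ℝ≥0∞ :=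
  (patternCount F V Λ (openCube d R) : ℝ≥0∞) / volume (openCube d R)

/-- The lower frequency, in `[0, ∞]`. -/
noncomputable def lowerFreq {d m : ℕ} (F : Set (ColSpace d m)) (V : Set (Fin d → ℝ))
    (Λ : Set (ColSpace d m)) : ℝ≥0∞ :=
  liminf (fun R : ℝ => patternDensity F V Λ R) atTop

/-- The upper frequency, in `[0, ∞]`. -/
noncomputable def upperFreq {d m : ℕ} (F : Set (ColSpace d m)) (V : Set (Fin d → ℝ))
    (Λ : Set (ColSpace d m)) : ℝ≥0∞ :=
  limsup (fun R : ℝ => patternDensity F V Λ R) atTop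

/-- The (unnormalized) Palm measure of a Borel set `D` of point measures, computed with the
window `B`: `ℓ(B)⁻¹ ∫ ∑_{x ∈ B ∩ Λ^↓} 1_D(-x + Λ) dμ(Λ)`. For stationary `μ` the value does not
depend on the bounded Borel set `B` of positive Lebesgue measure. -/
noncomputable def palm {d m : ℕ} (μ : Measure (PointMeasure d m)) (B : Set (Fin d → ℝ))
    (D : Set (PointMeasure d m)) : ℝ≥0∞ :=
  (volume B)⁻¹ * ∫⁻ ξ, ∑' x : ↥(B ∩ flatten ξ.points),
    D.indicator (fun _ => (1 : ℝ≥0∞)) ((-(x : Fin d → ℝ)) +ᵥ ξ) ∂μ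

/-! For every pattern the density of occurrences converges almost surely to the Palm value, so
liminf and limsup are both that limit. The positions at which the pattern occurs form a random
measure `occMeasure` that moves along with translations of the configuration. By stationarity its
mean is a translation-invariant, locally finite measure, hence a multiple of Lebesgue measure. The
factor is the Palm measure of the pattern set (`palm_patternSet_eq_of_volume_eq_one`).

The limit is a multidimensional ergodic theorem, obtained one coordinate at a time. Lengthening one
side of a box from `[0, 1)` to `[-n, n)` is a Birkhoff average along a unit translation
(`occAverage_succ`). The averaged function itself depends on `n`, so Birkhoff's theorem is extended
to boundedly convergent sequences of functions (`ae_tendsto_birkhoffAverage_of_tendsto_of_bound`). A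
single translation need not be ergodic, so along the induction only the integral of the limit is
kept. Once all sides are long, the limit is invariant under all of `ℝ^d`, hence constant and equal
to its integral (`exists_ae_tendsto_occAverage_const`).

Finally the count in `C_R` is squeezed between occurrence counts in boxes with integer half-sides
`⌊R/2⌋ - k` and `⌊R/2⌋ + 1`; the ratio of volumes tends to `1`. -/

theorem limsup_eq_limsup_of_tendsto_sub {u v : ℕ → ℝ} (hu : Bornology.IsBounded (range u))
    (hv : Bornology.IsBounded (range v)) (h : Tendsto (fun n => u n - v n) atTop (𝓝 0)) :
    limsup u atTop = limsup v atTop := by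
  have key : ∀ u v : ℕ → ℝ, Bornology.IsBounded (range u) → Bornology.IsBounded (range v) →
      Tendsto (fun n => u n - v n) atTop (𝓝 0) → limsup u atTop ≤ limsup v atTop := by
    intro u v hu hv h
    refine le_of_forall_pos_le_add fun ε hε => ?_
    have h1 : ∀ᶠ n in atTop, v n < limsup v atTop + ε / 2 :=
      eventually_lt_of_limsup_lt (by linarith) hv.bddAbove.isBoundedUnder_of_range
    have h2 : ∀ᶠ n in atTop, u n - v n < ε / 2 := h.eventually_lt_const (by linarith)
    refine limsup_le_of_le hu.bddBelow.isBoundedUnder_of_range.isCoboundedUnder_le ?_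
    filter_upwards [h1, h2] with n h1 h2
    linarith
  refine le_antisymm (key u v hu hv h) (key v u hv hu ?_)
  simpa using h.neg

/-! ### Birkhoff's pointwise ergodic theorem for bounded functions -/

section Birkhoff

variable {Ω : Type*}

/-- The running maximum of the Birkhoff sums `0, S_1 f, …, S_n f`. -/
noncomputable def birkhoffMax (T : Ω → Ω) (f : Ω → ℝ) : ℕ → Ω → ℝ
  | 0 => 0
  | n + 1 => fun x => max 0 (f x + birkhoffMax T f n (T x))

theorem birkhoffMax_nonneg (T : Ω → Ω) (f : Ω → ℝ) (n : ℕ) (x : Ω) :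
    0 ≤ birkhoffMax T f n x := by
  cases n with
  | zero => simp [birkhoffMax]
  | succ n => exact le_max_left _ _

theorem birkhoffMax_le_succ (T : Ω → Ω) (f : Ω → ℝ) (n : ℕ) (x : Ω) :
    birkhoffMax T f n x ≤ birkhoffMax T f (n + 1) x := by
  induction n generalizing x with
  | zero => exact birkhoffMax_nonneg T f 1 x
  | succ n ih => exact max_le_max le_rfl (by linarith [ih (T x)])

theorem birkhoffSum_le_birkhoffMax (T : Ω → Ω) (f : Ω → ℝ) (n : ℕ) (x : Ω) :
    birkhoffSum T f n x ≤ birkhoffMax T f n x := by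
  induction n generalizing x with
  | zero => simp [birkhoffMax]
  | succ n ih =>
    rw [birkhoffSum_succ']
    exact le_max_of_le_right (by linarith [ih (T x)])

theorem birkhoffSum_indicator_of_invariant {T : Ω → Ω} {A : Set Ω} (hA : T ⁻¹' A = A) (f : Ω → ℝ)
    (n : ℕ) {x : Ω} (hx : x ∈ A) : birkhoffSum T (A.indicator f) n x = birkhoffSum T f n x := by
  refine Finset.sum_congr rfl fun k _ => indicator_of_mem ?_ _
  clear * - hA hx
  induction k with
  | zero => exact hx
  | succ k ih => rw [Function.iterate_succ_apply', ← mem_preimage, hA]; exact ih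

theorem birkhoffMax_indicator_eq_zero {T : Ω → Ω} {A : Set Ω} (hA : T ⁻¹' A = A) (f : Ω → ℝ)
    (n : ℕ) {x : Ω} (hx : x ∉ A) : birkhoffMax T (A.indicator f) n x = 0 := by
  induction n generalizing x with
  | zero => rfl
  | succ n ih =>
    have : T x ∉ A := by rwa [← mem_preimage, hA]
    simp [birkhoffMax, ih this, hx]

theorem abs_birkhoffAverage_le {T : Ω → Ω} {f : Ω → ℝ} {C : ℝ} {x : Ω} (hC : 0 ≤ C)
    (h : ∀ k, |f (T^[k] x)| ≤ C) (n : ℕ) : |birkhoffAverage ℝ T f n x| ≤ C := by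
  simp only [birkhoffAverage, birkhoffSum, smul_eq_mul, abs_mul, abs_inv, Nat.abs_cast]
  rcases n.eq_zero_or_pos with rfl | hn
  · simpa using hC
  · rw [inv_mul_le_iff₀ (by positivity)]
    refine (Finset.abs_sum_le_sum_abs _ _).trans ((Finset.sum_le_sum fun k _ => h k).trans ?_)
    simp

theorem isBounded_range_birkhoffAverage (T : Ω → Ω) {f : Ω → ℝ} {C : ℝ} (hC : ∀ x, |f x| ≤ C)
    (x : Ω) : Bornology.IsBounded (range fun n => birkhoffAverage ℝ T f n x) := by
  refine (Metric.isBounded_closedBall (x := (0 : ℝ)) (r := C)).subset ?_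
  rintro _ ⟨n, rfl⟩
  rw [mem_closedBall_zero_iff, Real.norm_eq_abs]
  exact abs_birkhoffAverage_le ((abs_nonneg _).trans (hC x)) (fun k => hC _) n

variable [MeasurableSpace Ω] {μ : Measure Ω}

theorem measurable_birkhoffAverage {T : Ω → Ω} (hT : Measurable T) {f : Ω → ℝ}
    (hf : Measurable f) (n : ℕ) : Measurable fun x => birkhoffAverage ℝ T f n x := by
  simp only [birkhoffAverage, birkhoffSum, smul_eq_mul]
  exact (Finset.measurable_fun_sum _ fun k _ => hf.comp (hT.iterate k)).const_mul _

theorem integrable_birkhoffMax {T : Ω → Ω} (hT : MeasurePreserving T μ μ) {f : Ω → ℝ}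
    (hf : Integrable f μ) (n : ℕ) : Integrable (birkhoffMax T f n) μ := by
  induction n with
  | zero => exact integrable_zero _ _ _
  | succ n ih =>
    exact (integrable_zero _ _ _).sup (hf.add (hT.integrable_comp_of_integrable ih))

theorem measurable_birkhoffMax {T : Ω → Ω} (hT : Measurable T) {f : Ω → ℝ}
    (hf : Measurable f) (n : ℕ) : Measurable (birkhoffMax T f n) := by
  induction n with
  | zero => exact measurable_const
  | succ n ih => exact measurable_const.max (hf.add (ih.comp hT))

/-- The maximal ergodic theorem, in Garsia's form. -/
theorem setIntegral_birkhoffMax_pos_nonneg {T : Ω → Ω} (hT : MeasurePreserving T μ μ)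
    {f : Ω → ℝ} (hfm : Measurable f) (hf : Integrable f μ) (n : ℕ) :
    0 ≤ ∫ x in {x | 0 < birkhoffMax T f (n + 1) x}, f x ∂μ := by
  set M := birkhoffMax T f (n + 1) with hM
  have hMi : Integrable M μ := integrable_birkhoffMax hT hf (n + 1)
  have hMT : Integrable (M ∘ T) μ := hT.integrable_comp_of_integrable hMi
  have hS : MeasurableSet {x | 0 < M x} :=
    measurableSet_lt measurable_const (measurable_birkhoffMax hT.measurable hfm _)
  -- `M - M ∘ T` has integral zero by invariance and lies below `f` cut off to `{M > 0}`: where `M >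
  -- 0`, `M x` is `f x` plus the previous maximum at `T x`, which is at most `M (T x)`; elsewhere `M
  -- x = 0 ≤ M (T x)`.
  have h0 : ∫ x, (M x - M (T x)) ∂μ = 0 := by
    have h1 : ∫ x, M (T x) ∂μ = ∫ x, M x ∂μ := by
      conv_rhs => rw [← hT.map_eq]
      rw [integral_map hT.aemeasurable]
      rw [hT.map_eq]; exact hMi.aestronglyMeasurable
    rw [integral_sub (f := M) (g := fun x => M (T x)) hMi hMT, h1, sub_self]
  rw [← integral_indicator hS]
  refine h0.symm.le.trans ?_
  refine integral_mono (hMi.sub hMT) (hf.indicator hS) fun x => ?_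
  by_cases hx : 0 < M x
  · rw [indicator_of_mem (by exact hx)]
    have h2 : M x = max 0 (f x + birkhoffMax T f n (T x)) := rfl
    have h3 : M x = f x + birkhoffMax T f n (T x) := by
      rcases max_choice 0 (f x + birkhoffMax T f n (T x)) with h | h <;> rw [h] at h2
      · linarith
      · exact h2
    have := birkhoffMax_le_succ T f n (T x)
    simp only [hM] at *
    linarith
  · rw [indicator_of_notMem (by exact hx)]
    have := birkhoffMax_nonneg T f (n + 1) (T x)
    simp only [hM] at *
    linarith

/-- Apply the maximal theorem to `f` cut off to the invariant set `A`. The running maxima vanish off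
`A`, and every point of `A` eventually has a positive one, so the sets in the maximal theorem
increase to `A`. -/
theorem setIntegral_nonneg_of_exists_birkhoffSum_pos {T : Ω → Ω} (hT : MeasurePreserving T μ μ)
    {f : Ω → ℝ} (hfm : Measurable f) (hf : Integrable f μ) {A : Set Ω} (hAm : MeasurableSet A)
    (hA : T ⁻¹' A = A) (hpos : ∀ x ∈ A, ∃ n, 0 < birkhoffSum T f n x) :
    0 ≤ ∫ x in A, f x ∂μ := by
  set h := A.indicator f with hh
  have hhm : Measurable h := hfm.indicator hAm
  have hhi : Integrable h μ := hf.indicator hAm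
  set E : ℕ → Set Ω := fun n => {x | 0 < birkhoffMax T h (n + 1) x} with hE
  have hEm : ∀ n, MeasurableSet (E n) := fun n =>
    measurableSet_lt measurable_const (measurable_birkhoffMax hT.measurable hhm _)
  have hmono : Monotone E := monotone_nat_of_le_succ fun n x hx =>
    lt_of_lt_of_le (show 0 < birkhoffMax T h (n + 1) x from hx) (birkhoffMax_le_succ T h (n + 1) x)
  have hU : ⋃ n, E n = A := by
    ext x
    simp only [mem_iUnion]
    constructor
    · rintro ⟨n, hn⟩
      by_contra hx
      have h1 : 0 < birkhoffMax T h (n + 1) x := hn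
      rw [hh, birkhoffMax_indicator_eq_zero hA f _ hx] at h1
      exact lt_irrefl _ h1
    · intro hx
      obtain ⟨n, hn⟩ := hpos x hx
      refine ⟨n, lt_of_lt_of_le hn ?_⟩
      rw [← birkhoffSum_indicator_of_invariant hA f n hx]
      exact (birkhoffSum_le_birkhoffMax T h n x).trans (birkhoffMax_le_succ T h n x)
  have hlim := tendsto_setIntegral_of_monotone hEm hmono hhi.integrableOn
  rw [hU] at hlim
  have h1 : ∫ x in A, h x ∂μ = ∫ x in A, f x ∂μ :=
    setIntegral_congr_fun hAm fun x hx => indicator_of_mem hx _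
  rw [← h1]
  exact ge_of_tendsto' hlim fun n => setIntegral_birkhoffMax_pos_nonneg hT hhm hhi n

/-- The set `A` where the limsup exceeds `e + ε` is invariant, and on it some Birkhoff sum of `f - e
- ε` is positive. The maximal theorem gives `∫_A (f - e - ε) ≥ 0`, while `∫_A (f - e) = 0` because
`e` is the conditional expectation; hence `ε μ(A) ≤ 0`. Applied to `f` and `-f` this yields
convergence. -/
theorem ae_eventually_birkhoffAverage_lt [IsFiniteMeasure μ] {T : Ω → Ω}
    (hT : MeasurePreserving T μ μ) {f : Ω → ℝ} (hf : Measurable f) {C : ℝ} (hC : ∀ x, |f x| ≤ C) :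
    ∀ᵐ x ∂μ, ∀ ε > 0, ∀ᶠ n in atTop,
      birkhoffAverage ℝ T f n x < (μ[f|MeasurableSpace.invariants T]) x + ε := by
  have hle := MeasurableSpace.invariants_le T
  set e := μ[f|MeasurableSpace.invariants T] with he
  have hem : Measurable[MeasurableSpace.invariants T] e := stronglyMeasurable_condExp.measurable
  have hei : Integrable e μ := integrable_condExp
  have hfi : Integrable f μ := Integrable.of_bound hf.aestronglyMeasurable C
    (Eventually.of_forall hC)
  have heT : e ∘ T = e := MeasurableSpace.comp_eq_of_measurable_invariants hem
  set L : Ω → ℝ := fun x => limsup (fun n => birkhoffAverage ℝ T f n x) atTop with hL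
  have hbd := isBounded_range_birkhoffAverage T hC
  have hLT : L ∘ T = L := by
    funext x
    refine limsup_eq_limsup_of_tendsto_sub (hbd _) (hbd _) ?_
    refine tendsto_birkhoffAverage_apply_sub_birkhoffAverage ℝ ?_
    refine (Metric.isBounded_closedBall (x := (0 : ℝ)) (r := C)).subset ?_
    rintro _ ⟨n, rfl⟩
    rw [mem_closedBall_zero_iff, Real.norm_eq_abs]
    exact hC _
  have hLm : Measurable L := by
    exact Measurable.limsup fun n => measurable_birkhoffAverage hT.measurable hf n
  have hmain : ∀ ε > 0, ∀ᵐ x ∂μ, L x ≤ e x + ε := by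
    intro ε hε
    set A : Set Ω := {x | e x + ε < L x} with hA
    have hAm : MeasurableSet A := measurableSet_lt ((hem.mono hle le_rfl).add_const _) hLm
    have hAT : T ⁻¹' A = A := by
      ext x
      simp only [hA, mem_preimage, mem_ofPred_eq]
      rw [← Function.comp_apply (f := e), heT, ← Function.comp_apply (f := L), hLT]
    have hg : 0 ≤ ∫ x in A, (f x - e x - ε) ∂μ := by
      refine setIntegral_nonneg_of_exists_birkhoffSum_pos (f := fun x => f x - e x - ε) hT
        ((hf.sub (hem.mono hle le_rfl)).sub_const _) ((hfi.sub hei).sub (integrable_const _))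
        hAm hAT ?_
      intro x hx
      have h1 : ∃ᶠ n in atTop, e x + ε < birkhoffAverage ℝ T f n x :=
        frequently_lt_of_lt_limsup (hbd x).bddBelow.isBoundedUnder_of_range.isCoboundedUnder_le hx
      obtain ⟨n, hn, hn1⟩ := (h1.and_eventually (eventually_ge_atTop 1)).exists
      refine ⟨n, ?_⟩
      have hn0 : (0 : ℝ) < n := by exact_mod_cast hn1
      have h2 : birkhoffSum T (fun x => f x - e x - ε) n x
          = birkhoffSum T f n x - n * (e x + ε) := by
        have h3 : ∀ k, e (T^[k] x) = e x := fun k => by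
          induction k with
          | zero => rfl
          | succ k ih => rw [Function.iterate_succ_apply', ← ih]; exact congrFun heT _
        simp only [birkhoffSum, Finset.sum_sub_distrib, h3, Finset.sum_const, Finset.card_range,
          nsmul_eq_mul]
        ring
      rw [h2, sub_pos]
      simp only [birkhoffAverage, smul_eq_mul] at hn
      rwa [lt_inv_mul_iff₀ hn0] at hn
    have hAm' : MeasurableSet[MeasurableSpace.invariants T] A := ⟨hAm, hAT⟩
    have hce : ∫ x in A, e x ∂μ = ∫ x in A, f x ∂μ := setIntegral_condExp hle hfi hAm'
    rw [integral_sub (f := fun x => f x - e x) (hfi.sub hei).integrableOn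
      (integrable_const _).integrableOn, integral_sub hfi.integrableOn hei.integrableOn, hce] at hg
    have h4 : μ.real A * ε ≤ 0 := by simpa using hg
    have h5 : μ.real A = 0 := le_antisymm (by nlinarith) measureReal_nonneg
    have h6 : μ A = 0 := by rwa [measureReal_eq_zero_iff] at h5
    rw [ae_iff]
    simpa [hA] using h6
  have hall : ∀ᵐ x ∂μ, ∀ k : ℕ, L x ≤ e x + 1 / (k + 1 : ℝ) :=
    ae_all_iff.2 fun k => hmain _ (by positivity)
  filter_upwards [hall] with x hx ε hε
  obtain ⟨k, hk⟩ := exists_nat_one_div_lt hε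
  exact eventually_lt_of_limsup_lt (lt_of_le_of_lt (hx k) (by linarith))
    (hbd x).bddAbove.isBoundedUnder_of_range

/-- Birkhoff's pointwise ergodic theorem for bounded functions. -/
theorem ae_tendsto_birkhoffAverage [IsFiniteMeasure μ] {T : Ω → Ω}
    (hT : MeasurePreserving T μ μ) {f : Ω → ℝ} (hf : Measurable f) {C : ℝ} (hC : ∀ x, |f x| ≤ C) :
    ∀ᵐ x ∂μ, Tendsto (fun n => birkhoffAverage ℝ T f n x) atTop
      (𝓝 ((μ[f|MeasurableSpace.invariants T]) x)) := by
  have h1 := ae_eventually_birkhoffAverage_lt hT hf hC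
  have h2 := ae_eventually_birkhoffAverage_lt hT hf.neg (C := C) (by simpa using hC)
  have h3 := condExp_neg (μ := μ) f (MeasurableSpace.invariants T)
  filter_upwards [h1, h2, h3] with x h1 h2 h3
  rw [Metric.tendsto_atTop']
  intro ε hε
  obtain ⟨N, hN⟩ := eventually_atTop.1 ((h1 ε hε).and (h2 ε hε))
  refine ⟨N, fun n hn => ?_⟩
  obtain ⟨h4, h5⟩ := hN n hn.le
  rw [h3, birkhoffAverage_neg] at h5
  simp only [Pi.neg_apply] at h5
  rw [Real.dist_eq, abs_lt]
  constructor <;> linarith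

end Birkhoff

/-! ### Birkhoff averages of functions that vary with the length of the average -/

theorem abs_birkhoffAverage_sub_le {Ω : Type*} (T : Ω → Ω) {f g h : Ω → ℝ} (hfg : ∀ x, |f x - g x| ≤ h x)
    (n : ℕ) (x : Ω) :
    |birkhoffAverage ℝ T f n x - birkhoffAverage ℝ T g n x| ≤ birkhoffAverage ℝ T h n x := by
  simp only [birkhoffAverage, birkhoffSum, smul_eq_mul]
  rw [← mul_sub, ← Finset.sum_sub_distrib, abs_mul,
    abs_of_nonneg (by positivity : (0 : ℝ) ≤ (n : ℝ)⁻¹)]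
  exact mul_le_mul_of_nonneg_left ((Finset.abs_sum_le_sum_abs _ _).trans
    (Finset.sum_le_sum fun k _ => hfg _)) (by positivity)

section BirkhoffSequence

variable {Ω : Type*} [MeasurableSpace Ω] {μ : Measure Ω}

/-- By Fatou's lemma the liminf of `e k` has integral zero, so it vanishes almost everywhere. -/
theorem ae_forall_exists_lt_of_tendsto_integral {e : ℕ → Ω → ℝ} (he : ∀ k, Integrable (e k) μ)
    (hm : ∀ k, Measurable (e k)) (h0 : ∀ k, 0 ≤ᵐ[μ] e k)
    (hlim : Tendsto (fun k => ∫ x, e k x ∂μ) atTop (𝓝 0)) :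
    ∀ᵐ x ∂μ, ∀ ε > 0, ∃ k, e k x < ε := by
  have h1 : Tendsto (fun k => ∫⁻ x, ENNReal.ofReal (e k x) ∂μ) atTop (𝓝 0) := by
    simp_rw [← ofReal_integral_eq_lintegral_ofReal (he _) (h0 _)]
    simpa using ENNReal.tendsto_ofReal hlim
  have hm' : ∀ k, Measurable fun x => ENNReal.ofReal (e k x) := fun k => (hm k).ennreal_ofReal
  have h2 : ∫⁻ x, liminf (fun k => ENNReal.ofReal (e k x)) atTop ∂μ = 0 := by
    refine le_antisymm ?_ zero_le
    rw [← h1.liminf_eq]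
    exact lintegral_liminf_le hm'
  rw [lintegral_eq_zero_iff (Measurable.liminf hm')] at h2
  filter_upwards [h2] with x hx ε hε
  have h3 : liminf (fun k => ENNReal.ofReal (e k x)) atTop < ENNReal.ofReal ε := by
    rw [hx]; simpa using hε
  obtain ⟨k, hk⟩ := (frequently_lt_of_liminf_lt (by isBoundedDefault) h3).exists
  exact ⟨k, (ENNReal.ofReal_lt_ofReal_iff hε).1 hk⟩

/-- Birkhoff averages of length `n` of functions `G n` that converge boundedly to `g`. -/
theorem ae_tendsto_birkhoffAverage_of_tendsto_of_bound [IsFiniteMeasure μ] {T : Ω → Ω}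
    (hT : MeasurePreserving T μ μ) {G : ℕ → Ω → ℝ} {g : Ω → ℝ} {C : ℝ}
    (hG : ∀ n, Measurable (G n)) (hg : Measurable g) (hGC : ∀ n x, |G n x| ≤ C)
    (hgC : ∀ x, |g x| ≤ C) (hlim : ∀ᵐ x ∂μ, Tendsto (fun n => G n x) atTop (𝓝 (g x))) :
    ∀ᵐ x ∂μ, Tendsto (fun n => birkhoffAverage ℝ T (G n) n x) atTop
      (𝓝 ((μ[g|MeasurableSpace.invariants T]) x)) := by
  -- The tail supremum `h k` dominates `|G n - g|` for every `n ≥ k`. For fixed `k` its averages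
  -- converge by the ordinary theorem, and the limit is small for suitable `k` because `h k → 0`
  -- boundedly.
  set h : ℕ → Ω → ℝ := fun k x => ⨆ n, |G (n + k) x - g x| with hh
  have hb : ∀ k x n, |G (n + k) x - g x| ≤ 2 * C := fun k x n => by
    have := abs_sub (G (n + k) x) (g x)
    linarith [hGC (n + k) x, hgC x]
  have hbdd : ∀ k x, BddAbove (range fun n => |G (n + k) x - g x|) := fun k x => by
    refine ⟨2 * C, ?_⟩
    rintro _ ⟨n, rfl⟩
    exact hb k x n
  have hh0 : ∀ k x, 0 ≤ h k x := fun k x => Real.iSup_nonneg fun n => abs_nonneg _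
  have hhC : ∀ k x, |h k x| ≤ 2 * C := fun k x => by
    rw [abs_of_nonneg (hh0 k x)]
    exact ciSup_le fun n => hb k x n
  have hhm : ∀ k, Measurable (h k) := fun k =>
    Measurable.iSup fun n => ((hG (n + k)).sub hg).abs
  have hhlim : ∀ᵐ x ∂μ, Tendsto (fun k => h k x) atTop (𝓝 0) := by
    filter_upwards [hlim] with x hx
    rw [Metric.tendsto_atTop] at hx ⊢
    intro ε hε
    obtain ⟨N, hN⟩ := hx (ε / 2) (by linarith)
    refine ⟨N, fun k hk => ?_⟩
    rw [Real.dist_eq, sub_zero, abs_of_nonneg (hh0 k x)]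
    refine lt_of_le_of_lt (ciSup_le fun n => ?_) (half_lt_self hε)
    have := hN (n + k) (by omega)
    rw [Real.dist_eq] at this
    exact this.le
  set e : ℕ → Ω → ℝ := fun k => μ[h k|MeasurableSpace.invariants T] with he
  have hle := MeasurableSpace.invariants_le T
  have hint : Tendsto (fun k => ∫ x, e k x ∂μ) atTop (𝓝 0) := by
    simp only [he, integral_condExp hle]
    have := tendsto_integral_of_dominated_convergence (μ := μ) (F := h) (f := fun _ => 0)
      (fun _ => 2 * C) (fun k => (hhm k).aestronglyMeasurable) (integrable_const _)
      (fun k => Eventually.of_forall (hhC k)) hhlim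
    simpa using this
  have hsmall := ae_forall_exists_lt_of_tendsto_integral (μ := μ) (e := e)
    (fun k => integrable_condExp)
    (fun k => (stronglyMeasurable_condExp.measurable.mono hle le_rfl))
    (fun k => condExp_nonneg (Eventually.of_forall (hh0 k))) hint
  have hB := ae_all_iff.2 fun k => ae_tendsto_birkhoffAverage hT (hhm k) (hhC k)
  filter_upwards [hsmall, hB, ae_tendsto_birkhoffAverage hT hg hgC] with x h1 h2 h3
  rw [Metric.tendsto_atTop] at h3 ⊢
  intro ε hε
  obtain ⟨k, hk⟩ := h1 (ε / 2) (by linarith)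
  obtain ⟨N₁, hN₁⟩ := eventually_atTop.1 ((h2 k).eventually_lt_const hk)
  obtain ⟨N₂, hN₂⟩ := h3 (ε / 2) (by linarith)
  refine ⟨max k (max N₁ N₂), fun n hn => ?_⟩
  have hnk : k ≤ n := le_trans (le_max_left _ _) hn
  have h4 := hN₁ n (by omega)
  have h5 := hN₂ n (by omega)
  have h6 : |birkhoffAverage ℝ T (G n) n x - birkhoffAverage ℝ T g n x|
      ≤ birkhoffAverage ℝ T (h k) n x := by
    refine abs_birkhoffAverage_sub_le T (fun y => ?_) n x
    have := le_ciSup (hbdd k y) (n - k)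
    simpa [Nat.sub_add_cancel hnk] using this
  rw [Real.dist_eq] at h5 ⊢
  have h7 := abs_sub_le (birkhoffAverage ℝ T (G n) n x) (birkhoffAverage ℝ T g n x)
    ((μ[g|MeasurableSpace.invariants T]) x)
  linarith

/-- Truncating at `±C` turns almost sure bounds into everywhere bounds. Almost every orbit satisfies
the bounds at all times, so the truncation does not alter the averages there. -/
theorem exists_ae_tendsto_birkhoffAverage_of_tendsto [IsFiniteMeasure μ] {T : Ω → Ω}
    (hT : MeasurePreserving T μ μ) {G : ℕ → Ω → ℝ} {g : Ω → ℝ} {C : ℝ}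
    (hG : ∀ n, Measurable (G n)) (hg : Measurable g) (hGC : ∀ n, ∀ᵐ x ∂μ, |G n x| ≤ C)
    (hlim : ∀ᵐ x ∂μ, Tendsto (fun n => G n x) atTop (𝓝 (g x))) :
    ∃ g' : Ω → ℝ, Measurable g' ∧ Integrable g' μ ∧ ∫ x, g' x ∂μ = ∫ x, g x ∂μ ∧
      ∀ᵐ x ∂μ, Tendsto (fun n => birkhoffAverage ℝ T (G n) n x) atTop (𝓝 (g' x)) := by
  rcases isEmpty_or_nonempty Ω with hΩ | hΩ
  · exact ⟨g, hg, Integrable.of_finite, rfl, Eventually.of_forall fun x => (hΩ.false x).elim⟩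
  -- The bound `0 ≤ C` can be read off from the almost everywhere bound only when `μ` is nonzero.
  rcases eq_or_ne μ 0 with rfl | hμ
  · exact ⟨g, hg, integrable_zero_measure, rfl, by simp⟩
  have : NeZero μ := ⟨hμ⟩
  have hC0 : 0 ≤ C := by
    obtain ⟨x, hx⟩ := (hGC 0).exists
    exact (abs_nonneg _).trans hx
  set cl : ℝ → ℝ := fun y => max (-C) (min C y) with hcl
  have hclm : Measurable cl := measurable_const.max (measurable_const.min measurable_id)
  have hclC : ∀ y, |cl y| ≤ C := fun y => by
    rw [abs_le]
    exact ⟨le_max_left _ _, max_le (by linarith) (min_le_left _ _)⟩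
  have hcle : ∀ y, |y| ≤ C → cl y = y := fun y hy => by
    rw [abs_le] at hy
    simp only [hcl]
    rw [min_eq_right hy.2, max_eq_right hy.1]
  have hclc : Continuous cl := by fun_prop
  have hall : ∀ᵐ x ∂μ, ∀ n, |G n x| ≤ C := ae_all_iff.2 hGC
  have hall' : ∀ᵐ x ∂μ, ∀ k n, |G n (T^[k] x)| ≤ C := ae_all_iff.2 fun k =>
    (hT.iterate k).quasiMeasurePreserving.ae hall
  have hgg : (fun x => cl (g x)) =ᵐ[μ] g := by
    filter_upwards [hall, hlim] with x h1 h2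
    exact hcle _ (le_of_tendsto' h2.abs h1)
  have hle := MeasurableSpace.invariants_le T
  refine ⟨μ[fun x => cl (g x)|MeasurableSpace.invariants T],
    stronglyMeasurable_condExp.measurable.mono hle le_rfl, integrable_condExp, ?_, ?_⟩
  · rw [integral_condExp hle]
    exact integral_congr_ae hgg
  · have := ae_tendsto_birkhoffAverage_of_tendsto_of_bound hT (G := fun n x => cl (G n x))
      (g := fun x => cl (g x)) (fun n => hclm.comp (hG n)) (hclm.comp hg)
      (fun n x => hclC _) (fun x => hclC _) (by
        filter_upwards [hlim] with x hx
        exact (hclc.tendsto _).comp hx)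
    filter_upwards [this, hall'] with x h1 h2
    refine h1.congr fun n => ?_
    simp only [birkhoffAverage, birkhoffSum]
    congr 1
    exact Finset.sum_congr rfl fun k _ => hcle _ (h2 k n)

end BirkhoffSequence

/-! ### Compact exhaustion of the coloured space, with continuous cutoffs -/

section ColouredBoxes

variable {d m : ℕ}

/-- The coloured points at distance at most `n` from the origin. -/
def colBox (d m : ℕ) (n : ℕ) : Set (ColSpace d m) := {z | ‖z.1‖ ≤ n}

theorem isCompact_colBox (n : ℕ) : IsCompact (colBox d m n) := by
  have : colBox d m n = Metric.closedBall 0 (n : ℝ) ×ˢ univ := by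
    ext z; simp [colBox]
  rw [this]
  exact (isCompact_closedBall _ _).prod isCompact_univ

theorem monotone_colBox : Monotone (colBox d m) := fun n k h z hz =>
  le_trans (show ‖z.1‖ ≤ n from hz) (by exact_mod_cast h)

theorem iUnion_colBox : ⋃ n, colBox d m n = univ := by
  refine eq_univ_of_forall fun z => mem_iUnion.2 ?_
  obtain ⟨n, hn⟩ := exists_nat_ge ‖z.1‖
  exact ⟨n, hn⟩

theorem exists_subset_colBox {K : Set (ColSpace d m)} (hK : IsCompact K) :
    ∃ n, K ⊆ colBox d m n := by
  obtain ⟨C, hC⟩ := (hK.image continuous_fst).isBounded.exists_norm_le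
  obtain ⟨n, hn⟩ := exists_nat_ge C
  exact ⟨n, fun z hz => (hC _ (mem_image_of_mem _ hz)).trans hn⟩

/-- A continuous cutoff function equal to `1` on `colBox d m n`. -/
noncomputable def colCutoff (d m : ℕ) (n : ℕ) : CompactlySupportedContinuousMap (ColSpace d m) ℝ where
  toFun z := max 0 (min 1 (n + 1 - ‖z.1‖))
  continuous_toFun := by fun_prop
  hasCompactSupport' := by
    refine HasCompactSupport.intro (isCompact_colBox (n + 1)) fun z hz => ?_
    have : (n : ℝ) + 1 < ‖z.1‖ := by simpa [colBox] using hz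
    exact max_eq_left ((min_le_right _ _).trans (by linarith))

theorem colCutoff_apply (n : ℕ) (z : ColSpace d m) :
    colCutoff d m n z = max 0 (min 1 (n + 1 - ‖z.1‖)) := rfl

theorem colCutoff_nonneg (n : ℕ) (z : ColSpace d m) : 0 ≤ colCutoff d m n z := le_max_left _ _

theorem colCutoff_eq_one {n : ℕ} {z : ColSpace d m} (hz : z ∈ colBox d m n) :
    colCutoff d m n z = 1 := by
  have : ‖z.1‖ ≤ n := hz
  rw [colCutoff_apply, min_eq_left (by linarith), max_eq_right zero_le_one]

end ColouredBoxes

/-! ### The vague topology and the action of translations -/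

namespace PointMeasure

variable {d m : ℕ}

theorem measure_ne_top_of_isCompact (ξ : PointMeasure d m) {K : Set (ColSpace d m)}
    (hK : IsCompact K) : ξ.toMeasure K ≠ ∞ := by
  obtain ⟨n, hn⟩ := ξ.nat_valued K hK.measurableSet (by rwa [hK.isClosed.closure_eq])
  simp [hn]

instance (ξ : PointMeasure d m) : IsFiniteMeasureOnCompacts ξ.toMeasure :=
  ⟨fun _ hK => (ξ.measure_ne_top_of_isCompact hK).lt_top⟩

theorem continuous_integral (f : CompactlySupportedContinuousMap (ColSpace d m) ℝ) :
    Continuous fun ξ : PointMeasure d m => ∫ z, f z ∂ξ.toMeasure := by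
  have h : Continuous fun (ξ : PointMeasure d m)
      (f : CompactlySupportedContinuousMap (ColSpace d m) ℝ) => ∫ z, f z ∂ξ.toMeasure :=
    continuous_induced_dom
  exact (continuous_apply f).comp h

theorem toMeasure_vadd (t : Fin d → ℝ) (ξ : PointMeasure d m) :
    (t +ᵥ ξ).toMeasure = ξ.toMeasure.map (shift t) := rfl

theorem continuous_shift (t : Fin d → ℝ) : Continuous (shift (m := m) t) := by
  unfold shift; fun_prop

theorem shift_shift (s t : Fin d → ℝ) (z : ColSpace d m) : shift s (shift t z) = shift (s + t) z := by
  simp [shift, add_assoc]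

theorem continuous_vadd (t : Fin d → ℝ) : Continuous fun ξ : PointMeasure d m => t +ᵥ ξ := by
  refine continuous_induced_rng.2 (continuous_pi fun f => ?_)
  let e : ColSpace d m ≃ₜ ColSpace d m :=
    { toFun := shift t
      invFun := shift (-t)
      left_inv := fun z => by simp [shift]
      right_inv := fun z => by simp [shift]
      continuous_toFun := continuous_shift t
      continuous_invFun := continuous_shift (-t) }
  let g : CompactlySupportedContinuousMap (ColSpace d m) ℝ :=
    ⟨⟨fun z => f (shift t z), f.continuous.comp (continuous_shift t)⟩,
      f.hasCompactSupport.comp_homeomorph e⟩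
  refine (continuous_integral g).congr fun ξ => ?_
  exact (integral_map (measurable_shift t).aemeasurable
    (f := f) f.continuous.aestronglyMeasurable).symm

/-! ### Second countability of the vague topology -/

/-- The functions vanishing off a box have a countable dense subset in the compact-open topology, in
which uniform closeness on the compact box is an open condition. -/
theorem exists_countable_uniform_approx (n : ℕ) :
    ∃ D : Set (CompactlySupportedContinuousMap (ColSpace d m) ℝ), D.Countable ∧
      (∀ g ∈ D, ∀ z ∉ colBox d m n, g z = 0) ∧
      ∀ f : CompactlySupportedContinuousMap (ColSpace d m) ℝ, (∀ z ∉ colBox d m n, f z = 0) →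
        ∀ ε > 0, ∃ g ∈ D, ∀ z ∈ colBox d m n, |g z - f z| < ε := by
  let S : Set C(ColSpace d m, ℝ) := {f | ∀ z ∉ colBox d m n, f z = 0}
  obtain ⟨D, hDc, hD⟩ := TopologicalSpace.exists_countable_dense S
  let φ : S → CompactlySupportedContinuousMap (ColSpace d m) ℝ := fun f =>
    ⟨f.1, HasCompactSupport.intro (isCompact_colBox n) f.2⟩
  refine ⟨φ '' D, hDc.image φ, ?_, ?_⟩
  · rintro _ ⟨g, -, rfl⟩ z hz
    exact g.2 z hz
  · intro f hf ε hε
    let f' : S := ⟨f.toContinuousMap, hf⟩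
    have hopen : IsOpen {g : S | MapsTo (g.1 - f'.1) (colBox d m n) (Metric.ball (0 : ℝ) ε)} := by
      have h1 := ContinuousMap.isOpen_setOfPred_mapsTo (isCompact_colBox (d := d) (m := m) n)
        (Metric.isOpen_ball (x := (0 : ℝ)) (ε := ε))
      exact h1.preimage (continuous_subtype_val.sub continuous_const)
    obtain ⟨g, hg, hgD⟩ := hD.inter_open_nonempty _ hopen ⟨f', fun z _ => by simp [hε]⟩
    refine ⟨φ g, mem_image_of_mem φ hgD, fun z hz => ?_⟩
    have := hg hz
    rw [mem_ball_zero_iff] at this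
    exact this

/-- The bound uses the integral of the cutoff instead of the mass of the box, since the former is
vaguely continuous in `ξ`. -/
theorem abs_integral_sub_le (ξ : PointMeasure d m)
    {f g : CompactlySupportedContinuousMap (ColSpace d m) ℝ} {n : ℕ} {δ : ℝ}
    (hf : ∀ z ∉ colBox d m n, f z = 0) (hg : ∀ z ∉ colBox d m n, g z = 0)
    (hfg : ∀ z ∈ colBox d m n, |g z - f z| < δ) (hδ : 0 ≤ δ) :
    |∫ z, g z ∂ξ.toMeasure - ∫ z, f z ∂ξ.toMeasure| ≤ δ * ∫ z, colCutoff d m n z ∂ξ.toMeasure := by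
  rw [← integral_sub g.integrable f.integrable, ← integral_const_mul, ← Real.norm_eq_abs]
  refine norm_integral_le_of_norm_le ((colCutoff d m n).integrable.const_mul δ)
    (Eventually.of_forall fun z => ?_)
  by_cases hz : z ∈ colBox d m n
  · rw [colCutoff_eq_one hz, mul_one]
    exact (hfg z hz).le
  · rw [hf z hz, hg z hz]
    simpa using mul_nonneg hδ (colCutoff_nonneg n z)

/-- Countably many approximants and the cutoffs already induce the vague topology. Near `ξ₀` the
cutoff integral stays below `M + 1`, so replacing `f` by an approximant costs at most `ε / 3` at `ξ`
and at `ξ₀` alike. -/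
instance : SecondCountableTopology (PointMeasure d m) := by
  choose D hDc hD0 hD using fun n => exists_countable_uniform_approx (d := d) (m := m) n
  let I : Set (CompactlySupportedContinuousMap (ColSpace d m) ℝ) :=
    (⋃ n, D n) ∪ range (colCutoff d m)
  have hI : I.Countable := (countable_iUnion hDc).union (countable_range _)
  have : Countable I := hI.to_subtype
  let Φ : PointMeasure d m → (I → ℝ) := fun ξ f => ∫ z, f.1 z ∂ξ.toMeasure
  have hΦ : instTopologicalSpace (d := d) (m := m) =
      TopologicalSpace.induced Φ inferInstance := by
    refine le_antisymm ?_ ?_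
    · exact continuous_iff_le_induced.1 (continuous_pi fun f => continuous_integral f.1)
    · let τ : TopologicalSpace (PointMeasure d m) := TopologicalSpace.induced Φ inferInstance
      have hΦc : Continuous[τ, _] Φ := continuous_induced_dom
      have hcI : ∀ f ∈ I, Continuous[τ, _] fun ξ : PointMeasure d m => ∫ z, f z ∂ξ.toMeasure :=
        fun f hf => (continuous_apply (⟨f, hf⟩ : I)).comp hΦc
      refine continuous_iff_le_induced.1 (continuous_pi fun f => ?_)
      rw [continuous_iff_continuousAt]
      intro ξ₀
      obtain ⟨n, hn⟩ := exists_subset_colBox f.hasCompactSupport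
      have hf0 : ∀ z ∉ colBox d m n, f z = 0 := fun z hz =>
        image_eq_zero_of_notMem_tsupport fun h => hz (hn h)
      rw [ContinuousAt, Metric.tendsto_nhds]
      intro ε hε
      set M : ℝ := ∫ z, colCutoff d m n z ∂ξ₀.toMeasure with hM
      have hM0 : 0 ≤ M := integral_nonneg (colCutoff_nonneg n)
      set δ : ℝ := ε / (3 * (M + 1)) with hδ
      have hδ0 : 0 < δ := by positivity
      have hδM : δ * (M + 1) = ε / 3 := by rw [hδ]; field_simp
      obtain ⟨g, hgD, hg⟩ := hD n f hf0 δ hδ0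
      have h1 := (hcI (colCutoff d m n) (Or.inr ⟨n, rfl⟩)).continuousAt (x := ξ₀)
      have h2 := (hcI g (Or.inl (mem_iUnion.2 ⟨n, hgD⟩))).continuousAt (x := ξ₀)
      have h3 := h1.eventually_lt_const (show _ < M + 1 by linarith)
      have h4 := (Metric.tendsto_nhds.1 h2) (ε / 3) (by linarith)
      filter_upwards [h3, h4] with ξ h3 h4
      have h5 := abs_integral_sub_le ξ hf0 (hD0 n g hgD) hg hδ0.le
      have h6 := abs_integral_sub_le ξ₀ hf0 (hD0 n g hgD) hg hδ0.le
      have h7 : δ * ∫ z, colCutoff d m n z ∂ξ.toMeasure ≤ δ * (M + 1) :=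
        mul_le_mul_of_nonneg_left h3.le hδ0.le
      have h8 : δ * M < δ * (M + 1) := mul_lt_mul_of_pos_left (by linarith) hδ0
      rw [Real.dist_eq] at h4 ⊢
      rw [abs_lt] at *
      rw [abs_le] at h5 h6
      constructor <;> linarith [h4.1, h4.2, h5.1, h5.2, h6.1, h6.2]
  have h := TopologicalSpace.secondCountableTopology_induced _ _ Φ
  rwa [← hΦ] at h

/-- The complement of the support is a union of open null sets; second countability lets countably
many of them suffice. -/
theorem ae_mem_support (μ : Measure (PointMeasure d m)) : ∀ᵐ ξ ∂μ, ξ ∈ μ.support :=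
  Measure.support_mem_ae

theorem measurePreserving_vadd {μ : Measure (PointMeasure d m)}
    [VAddInvariantMeasure (Fin d → ℝ) (PointMeasure d m) μ] (t : Fin d → ℝ) :
    MeasurePreserving (fun ξ : PointMeasure d m => t +ᵥ ξ) μ μ := by
  have hm : Measurable fun ξ : PointMeasure d m => t +ᵥ ξ := (continuous_vadd t).measurable
  refine ⟨hm, ?_⟩
  ext s hs
  rw [Measure.map_apply hm hs]
  exact VAddInvariantMeasure.measure_preimage_vadd t hs

theorem vadd_mem_support {μ : Measure (PointMeasure d m)}
    [VAddInvariantMeasure (Fin d → ℝ) (PointMeasure d m) μ] (t : Fin d → ℝ) {ξ : PointMeasure d m}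
    (hξ : ξ ∈ μ.support) : t +ᵥ ξ ∈ μ.support := by
  rw [Measure.mem_support_iff_forall] at hξ ⊢
  intro U hU
  have h1 : (fun ξ : PointMeasure d m => t +ᵥ ξ) ⁻¹' interior U ∈ 𝓝 ξ :=
    (continuous_vadd t).continuousAt (interior_mem_nhds.2 hU)
  have h2 := hξ _ h1
  rw [(measurePreserving_vadd t).measure_preimage isOpen_interior.measurableSet.nullMeasurableSet]
    at h2
  exact h2.trans_le (measure_mono interior_subset)

/-! ### Measurability of evaluations -/

/-- The indicator of the compact set is a dominated limit of compactly supported continuous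
functions, so its mass is a pointwise limit of vaguely continuous functions. -/
theorem measurable_measure_of_isClosed_inter {F : Set (ColSpace d m)} (hF : IsClosed F) (n : ℕ) :
    Measurable fun ξ : PointMeasure d m => ξ.toMeasure (F ∩ colBox d m n) := by
  have hK : IsCompact (F ∩ colBox d m n) := (isCompact_colBox n).inter_left hF
  set K := F ∩ colBox d m n with hKdef
  let f : ℕ → CompactlySupportedContinuousMap (ColSpace d m) ℝ := fun k =>
    ⟨⟨fun z => (hK.isClosed.apprSeq k z : ℝ) * colCutoff d m n z, by fun_prop⟩,
      (colCutoff d m n).hasCompactSupport.mul_left⟩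
  have hlim : ∀ ξ : PointMeasure d m,
      Tendsto (fun k => ∫ z, f k z ∂ξ.toMeasure) atTop (𝓝 (ξ.toMeasure.real K)) := by
    intro ξ
    rw [← integral_indicator_one hK.measurableSet]
    refine tendsto_integral_of_dominated_convergence (colCutoff d m n)
      (fun k => (f k).continuous.aestronglyMeasurable) (colCutoff d m n).integrable
      (fun k => Eventually.of_forall fun z => ?_) (Eventually.of_forall fun z => ?_)
    · have h1 : (hK.isClosed.apprSeq k z : ℝ) ≤ 1 := by
        exact_mod_cast HasOuterApproxClosed.apprSeq_apply_le_one hK.isClosed k z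
      change ‖(hK.isClosed.apprSeq k z : ℝ) * colCutoff d m n z‖ ≤ colCutoff d m n z
      rw [Real.norm_of_nonneg (mul_nonneg NNReal.zero_le_coe (colCutoff_nonneg n z))]
      exact mul_le_of_le_one_left (colCutoff_nonneg n z) h1
    · have h1 := (tendsto_pi_nhds.1 (HasOuterApproxClosed.tendsto_apprSeq hK.isClosed)) z
      have h2 := (NNReal.tendsto_coe.2 h1).mul_const (colCutoff d m n z)
      have h3 : K.indicator (1 : ColSpace d m → ℝ) z =
          ((K.indicator (fun _ => (1 : NNReal)) z : NNReal) : ℝ) * colCutoff d m n z := by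
        by_cases hz : z ∈ K
        · simp [hz, colCutoff_eq_one hz.2]
        · simp [hz]
      rw [h3]
      exact h2
  have hreal : Measurable fun ξ : PointMeasure d m => ξ.toMeasure.real K :=
    measurable_of_tendsto_metrizable (fun k => (continuous_integral (f k)).measurable)
      (tendsto_pi_nhds.2 hlim)
  simpa only [ofReal_measureReal (measure_ne_top_of_isCompact _ hK)] using hreal.ennreal_ofReal

theorem measurable_toMeasure : Measurable (toMeasure : PointMeasure d m → Measure (ColSpace d m)) := by
  refine Measure.measurable_of_measurable_coe _ fun A hA => ?_
  have h1 : ∀ n, Measurable fun ξ : PointMeasure d m => ξ.toMeasure (A ∩ colBox d m n) := by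
    intro n
    have hfin : ∀ ξ : PointMeasure d m, IsFiniteMeasure (ξ.toMeasure.restrict (colBox d m n)) :=
      fun ξ => ⟨by
        rw [Measure.restrict_apply_univ]
        exact (ξ.measure_ne_top_of_isCompact (isCompact_colBox n)).lt_top⟩
    have h2 : Measurable fun ξ : PointMeasure d m => ξ.toMeasure.restrict (colBox d m n) := by
      refine Measurable.measure_of_isPiSystem (S := {F | IsClosed F}) ?_ isPiSystem_isClosed ?_ ?_
      · rw [← borel_eq_generateFrom_isClosed]
        exact BorelSpace.measurable_eq
      · intro F hF
        simp_rw [Measure.restrict_apply (IsClosed.measurableSet hF)]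
        exact measurable_measure_of_isClosed_inter hF n
      · simp_rw [Measure.restrict_apply MeasurableSet.univ]
        exact measurable_measure_of_isClosed_inter isClosed_univ n
    have h3 := (Measure.measurable_coe hA).comp h2
    simpa [Function.comp_def, Measure.restrict_apply hA] using h3
  have h2 : (fun ξ : PointMeasure d m => ξ.toMeasure A) =
      fun ξ => ⨆ n, ξ.toMeasure (A ∩ colBox d m n) := by
    funext ξ
    rw [← Monotone.measure_iUnion fun i j h => inter_subset_inter_right A (monotone_colBox h),
      ← inter_iUnion, iUnion_colBox, inter_univ]
  rw [h2]
  exact Measurable.iSup h1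

/-- The identity kernel from point measures to coloured points. -/
noncomputable def kernel (d m : ℕ) : ProbabilityTheory.Kernel (PointMeasure d m) (ColSpace d m) :=
  ⟨toMeasure, measurable_toMeasure⟩

theorem kernel_apply (ξ : PointMeasure d m) : kernel d m ξ = ξ.toMeasure := rfl

open ProbabilityTheory in
instance : IsSFiniteKernel (kernel d m) := by
  classical
  let E : ℕ → Set (ColSpace d m) := disjointed (colBox d m)
  have hEm : ∀ n, MeasurableSet (E n) :=
    fun n => MeasurableSet.disjointed (fun n => (isCompact_colBox n).measurableSet) n
  have hEn : ∀ n (ξ : PointMeasure d m), ∃ k : ℕ, ξ.toMeasure (E n) = k := fun n ξ => by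
    refine ξ.nat_valued _ (hEm n) ((isCompact_colBox n).of_isClosed_subset isClosed_closure ?_)
    exact closure_minimal (disjointed_subset _ n) (isCompact_colBox n).isClosed
  have hSm : ∀ p : ℕ × ℕ, MeasurableSet {ξ : PointMeasure d m | ξ.toMeasure (E p.1) = p.2} :=
    fun p => ((Measure.measurable_coe (hEm p.1)).comp measurable_toMeasure)
      (measurableSet_singleton _)
  -- The mass of a shell `E n` is not bounded over all point measures, but it is a natural number.
  -- Sorting the point measures by that number gives countably many finite kernels.
  let κ : ℕ × ℕ → Kernel (PointMeasure d m) (ColSpace d m) := fun p =>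
    Kernel.piecewise (hSm p) ((kernel d m).restrict (hEm p.1)) 0
  have hκ : ∀ p, IsFiniteKernel (κ p) := fun p => by
    refine ⟨⟨p.2, by simp, fun ξ => ?_⟩⟩
    simp only [κ, Kernel.piecewise_apply]
    split_ifs with h
    · rw [Kernel.restrict_apply, Measure.restrict_apply_univ]
      exact le_of_eq h
    · simp
  have hsum : kernel d m = Kernel.sum κ := by
    ext ξ A hA
    rw [Kernel.sum_apply' _ _ hA, ENNReal.tsum_prod']
    have h1 : ∀ n, ∑' k, κ (n, k) ξ A = ξ.toMeasure (A ∩ E n) := fun n => by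
      obtain ⟨k, hk⟩ := hEn n ξ
      rw [tsum_eq_single k]
      · simp only [κ, Kernel.piecewise_apply]
        rw [if_pos (by exact hk), Kernel.restrict_apply, Measure.restrict_apply hA, kernel_apply]
      · intro j hj
        simp only [κ, Kernel.piecewise_apply]
        rw [if_neg]
        · simp
        · intro h
          have h' : ξ.toMeasure (E n) = j := h
          rw [hk] at h'
          exact hj (by exact_mod_cast h'.symm)
    simp_rw [h1]
    rw [kernel_apply, ← measure_iUnion
      (fun i j h => (disjoint_disjointed _ h).mono inter_subset_right inter_subset_right)
      (fun n => hA.inter (hEm n)), ← inter_iUnion, iUnion_disjointed, iUnion_colBox, inter_univ]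
  rw [hsum]
  infer_instance

end PointMeasure

theorem isOpen_openCube (d : ℕ) (R : ℝ) : IsOpen (openCube d R) := by
  have : openCube d R = ⋂ i, {x : Fin d → ℝ | |x i| < R / 2} := by ext; simp [openCube]
  rw [this]
  exact isOpen_iInter_of_finite fun i =>
    isOpen_lt (continuous_apply i).abs continuous_const

theorem zero_mem_openCube {d : ℕ} {r : ℝ} (hr : 0 < r) : (0 : Fin d → ℝ) ∈ openCube d r :=
  fun i => by simpa using hr

namespace PointMeasure

variable {d m : ℕ}

/-! ### Atoms -/

theorem exists_nat_eq_of_subset_colBox (ξ : PointMeasure d m) {A : Set (ColSpace d m)}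
    (hA : MeasurableSet A) {n : ℕ} (hAn : A ⊆ colBox d m n) : ∃ k : ℕ, ξ.toMeasure A = k :=
  ξ.nat_valued A hA ((isCompact_colBox n).of_isClosed_subset isClosed_closure
    (closure_minimal hAn (isCompact_colBox n).isClosed))

theorem exists_mem_points_of_measure_ne_zero (ξ : PointMeasure d m) {A : Set (ColSpace d m)}
    (hA : MeasurableSet A) (h : ξ.toMeasure A ≠ 0) : ∃ z ∈ A, z ∈ ξ.points := by
  obtain ⟨n, hn⟩ : ∃ n, ξ.toMeasure (A ∩ colBox d m n) ≠ 0 := by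
    by_contra! hc
    apply h
    rw [← inter_univ A, ← iUnion_colBox, inter_iUnion]
    exact measure_iUnion_null hc
  have hAn : MeasurableSet (A ∩ colBox d m n) := hA.inter (isCompact_colBox n).measurableSet
  set ν := ξ.toMeasure.restrict (A ∩ colBox d m n) with hν
  have hν0 : ν ≠ 0 := fun h0 => hn (by rwa [hν, Measure.restrict_eq_zero] at h0)
  obtain ⟨z, hz⟩ := Measure.nonempty_support hν0
  -- Integrality forces atoms: if `{z}` were null, outer regularity would give a neighbourhood of
  -- mass below `1`, hence of mass `0`, although `z` lies in the support.
  have hνz : ν {z} ≠ 0 := by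
    intro h0
    obtain ⟨U, hzU, hU, hU1⟩ := exists_isOpen_lt_of_lt (μ := ν) {z} 1 (by rw [h0]; exact one_pos)
    have hpos := (Measure.mem_support_iff_forall z).1 hz U
      (hU.mem_nhds (hzU (mem_singleton z)))
    rw [hν, Measure.restrict_apply hU.measurableSet] at hpos hU1
    obtain ⟨k, hk⟩ := ξ.exists_nat_eq_of_subset_colBox (hU.measurableSet.inter hAn)
      (inter_subset_right.trans inter_subset_right)
    rw [hk] at hpos hU1
    have h1 : 0 < k := by exact_mod_cast hpos
    have h2 : k < 1 := by exact_mod_cast hU1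
    omega
  rw [hν, Measure.restrict_apply (measurableSet_singleton z)] at hνz
  obtain ⟨w, hw⟩ := nonempty_of_measure_ne_zero hνz
  obtain ⟨rfl, hwA⟩ := hw
  exact ⟨w, hwA.1, fun h0 => hνz (measure_mono_null inter_subset_left h0)⟩

theorem measure_ne_zero_iff (ξ : PointMeasure d m) {A : Set (ColSpace d m)}
    (hA : MeasurableSet A) : ξ.toMeasure A ≠ 0 ↔ ∃ z ∈ A, z ∈ ξ.points := by
  refine ⟨ξ.exists_mem_points_of_measure_ne_zero hA, ?_⟩
  rintro ⟨z, hzA, hz⟩ h0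
  exact hz (measure_mono_null (singleton_subset_iff.2 hzA) h0)

theorem countable_points (ξ : PointMeasure d m) : ξ.points.Countable := by
  have := Measure.countable_meas_pos_of_disjoint_iUnion (μ := ξ.toMeasure)
    (As := fun z : ColSpace d m => {z}) (fun z => measurableSet_singleton z)
    (fun z w h => disjoint_singleton.2 h)
  simpa only [points, pos_iff_ne_zero] using this

theorem measure_eq_tsum (ξ : PointMeasure d m) {A : Set (ColSpace d m)} (hA : MeasurableSet A) :
    ξ.toMeasure A = ∑' z : ↥(A ∩ ξ.points), ξ.toMeasure {(z : ColSpace d m)} := by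
  have hp := ξ.countable_points
  have h0 : ξ.toMeasure (A \ ξ.points) = 0 := by
    by_contra h
    obtain ⟨z, hz, hz'⟩ := ξ.exists_mem_points_of_measure_ne_zero
      (hA.diff hp.measurableSet) h
    exact hz.2 hz'
  have h1 := measure_inter_add_sdiff (μ := ξ.toMeasure) A hp.measurableSet
  have h2 := lintegral_countable (μ := ξ.toMeasure) (fun _ => 1)
    (hp.mono (inter_subset_right : A ∩ ξ.points ⊆ ξ.points))
  rw [← h1, h0, add_zero]
  simpa using h2

theorem points_vadd (t : Fin d → ℝ) (ξ : PointMeasure d m) :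
    (t +ᵥ ξ).points = shift t '' ξ.points := by
  ext z
  have h1 : (t +ᵥ ξ).toMeasure {z} = ξ.toMeasure {shift (-t) z} := by
    rw [toMeasure_vadd, Measure.map_apply (measurable_shift t) (measurableSet_singleton z)]
    congr 1
    ext w
    simp only [mem_preimage, mem_singleton_iff]
    constructor
    · rintro rfl; simp [shift]
    · rintro rfl; simp [shift]
  constructor
  · intro hz
    exact ⟨shift (-t) z, by simpa [points, h1] using hz, by simp [shift]⟩
  · rintro ⟨w, hw, rfl⟩
    have : shift (-t) (shift t w) = w := by simp [shift]
    simpa [points, h1, this] using hw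

/-! ### Uniformly discrete point measures -/

theorem measure_singleton_eq_one {r : ℝ} (hr : 0 < r) {ξ : PointMeasure d m}
    (hξ : ξ ∈ hardCore d m r) {z : ColSpace d m} (hz : z ∈ ξ.points) : ξ.toMeasure {z} = 1 := by
  have h1 : ξ.toMeasure {z} ≤ 1 := by
    refine (measure_mono ?_).trans (hξ z.1)
    rintro w rfl
    simpa using zero_mem_openCube hr
  obtain ⟨k, hk⟩ := ξ.nat_valued {z} (measurableSet_singleton z) (by simp)
  have h2 : ξ.toMeasure {z} ≠ 0 := hz
  rw [hk] at h1 h2 ⊢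
  have h3 : k ≤ 1 := by exact_mod_cast h1
  have h4 : k ≠ 0 := by exact_mod_cast h2
  have : k = 1 := by omega
  simp [this]

theorem injOn_fst_points {r : ℝ} (hr : 0 < r) {ξ : PointMeasure d m}
    (hξ : ξ ∈ hardCore d m r) : InjOn Prod.fst ξ.points := by
  intro z hz w hw hzw
  by_contra hne
  have h1 : ξ.toMeasure ({z} ∪ {w}) ≤ 1 := by
    refine (measure_mono ?_).trans (hξ z.1)
    rintro y (rfl | rfl)
    · simpa using zero_mem_openCube hr
    · simpa [hzw] using zero_mem_openCube hr
  rw [measure_union (disjoint_singleton.2 hne) (measurableSet_singleton w),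
    measure_singleton_eq_one hr hξ hz, measure_singleton_eq_one hr hξ hw] at h1
  norm_num at h1

theorem measure_eq_encard {r : ℝ} (hr : 0 < r) {ξ : PointMeasure d m}
    (hξ : ξ ∈ hardCore d m r) {A : Set (ColSpace d m)} (hA : MeasurableSet A) :
    ξ.toMeasure A = ((A ∩ ξ.points).encard : ℝ≥0∞) := by
  rw [measure_eq_tsum ξ hA, ← ENNReal.tsum_set_one]
  exact tsum_congr fun z => measure_singleton_eq_one hr hξ z.2.2

/-- The number of cubes needed to cover `A` bounds the mass, uniformly in `ξ`. -/
theorem exists_forall_measure_le {r : ℝ} (hr : 0 < r) {A : Set (Fin d → ℝ)}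
    (hA : Bornology.IsBounded A) :
    ∃ k : ℕ, ∀ ξ ∈ hardCore d m r, ξ.toMeasure {z | z.1 ∈ A} ≤ k := by
  obtain ⟨t, -, ht⟩ := hA.isCompact_closure.elim_nhds_subcover
    (fun a => {x | x - a ∈ openCube d r})
    (fun a _ => ((isOpen_openCube d r).preimage (continuous_id.sub continuous_const)).mem_nhds
      (by simpa using zero_mem_openCube hr))
  refine ⟨t.card, fun ξ hξ => ?_⟩
  have hsub : {z : ColSpace d m | z.1 ∈ A} ⊆ ⋃ a ∈ t, {z | z.1 - a ∈ openCube d r} := by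
    intro z hz
    have := ht (subset_closure hz)
    simpa using this
  calc ξ.toMeasure {z | z.1 ∈ A}
      ≤ ∑ a ∈ t, ξ.toMeasure {z | z.1 - a ∈ openCube d r} :=
        (measure_mono hsub).trans (measure_biUnion_finset_le _ _)
    _ ≤ ∑ a ∈ t, 1 := Finset.sum_le_sum fun a _ => hξ a
    _ = t.card := by simp

end PointMeasure

/-! ### Occurrences of a pattern -/

namespace PointMeasure

variable {d m : ℕ}

/-- The pattern `(F, V)` occurs in `ξ` at the position `x`. -/
def Occurs (F : Set (ColSpace d m)) (V : Set (Fin d → ℝ)) (ξ : PointMeasure d m)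
    (x : Fin d → ℝ) : Prop :=
  ∀ f ∈ F, ξ.toMeasure {w | w.2 = f.2 ∧ x + f.1 - w.1 ∈ V} ≠ 0

variable {F : Set (ColSpace d m)} {V : Set (Fin d → ℝ)}

theorem measurableSet_match (hV : MeasurableSet V) (x : Fin d → ℝ) (f : ColSpace d m) :
    MeasurableSet {w : ColSpace d m | w.2 = f.2 ∧ x + f.1 - w.1 ∈ V} :=
  (measurable_snd (measurableSet_singleton f.2)).inter
    (hV.preimage (measurable_fst.const_sub (x + f.1)))

theorem occurs_iff_subset_image (hV : MeasurableSet V) (ξ : PointMeasure d m) (x : Fin d → ℝ) :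
    Occurs F V ξ x ↔ F ⊆ shift (-x) '' setShift V ξ.points := by
  refine forall₂_congr fun f _ => ?_
  rw [measure_ne_zero_iff ξ (measurableSet_match hV x f)]
  constructor
  · rintro ⟨w, ⟨hw2, hwV⟩, hw⟩
    refine ⟨shift (x + f.1 - w.1) w, mem_biUnion hwV (mem_image_of_mem _ hw), ?_⟩
    ext1
    · simp [shift]
    · exact hw2
  · rintro ⟨_, hz, rfl⟩
    simp only [setShift, mem_iUnion] at hz
    obtain ⟨v, hv, w, hw, rfl⟩ := hz
    exact ⟨w, ⟨rfl, by simpa [shift] using hv⟩, hw⟩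

theorem occurs_iff_subset_setShift (hV : MeasurableSet V) (ξ : PointMeasure d m)
    (x : Fin d → ℝ) : Occurs F V ξ x ↔ F ⊆ setShift V ((-x) +ᵥ ξ).points := by
  rw [occurs_iff_subset_image hV, points_vadd]
  have : shift (-x) '' setShift V ξ.points = setShift V (shift (-x) '' ξ.points) := by
    simp only [setShift, image_iUnion, image_image, shift_shift, add_comm]
  rw [this]

theorem occurs_vadd (hV : MeasurableSet V) (t : Fin d → ℝ) (ξ : PointMeasure d m)
    (x : Fin d → ℝ) : Occurs F V (t +ᵥ ξ) (t + x) ↔ Occurs F V ξ x := by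
  refine forall₂_congr fun f _ => ?_
  rw [toMeasure_vadd, Measure.map_apply (measurable_shift t) (measurableSet_match hV _ f)]
  have : shift t ⁻¹' {w : ColSpace d m | w.2 = f.2 ∧ t + x + f.1 - w.1 ∈ V} =
      {w | w.2 = f.2 ∧ x + f.1 - w.1 ∈ V} := by
    ext w
    simp only [mem_preimage, shift, mem_ofPred_eq]
    rw [show t + x + f.1 - (t + w.1) = x + f.1 - w.1 by abel]
  rw [this]

/-- `Occurs` speaks of masses instead of points for this purpose: each condition says that a section
of a measurable set has nonzero mass, and s-finiteness of the kernel makes that mass jointly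
measurable in configuration and position. -/
theorem measurableSet_occurs (hF : F.Finite) (hV : MeasurableSet V) :
    MeasurableSet {p : PointMeasure d m × (Fin d → ℝ) | Occurs F V p.1 p.2} := by
  have h : {p : PointMeasure d m × (Fin d → ℝ) | Occurs F V p.1 p.2} =
      ⋂ f ∈ F, {p | p.1.toMeasure {w | w.2 = f.2 ∧ p.2 + f.1 - w.1 ∈ V} ≠ 0} := by
    ext p; simp [Occurs]
  rw [h]
  refine MeasurableSet.biInter hF.countable fun f _ => ?_
  have hS : MeasurableSet {q : (PointMeasure d m × (Fin d → ℝ)) × ColSpace d m |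
      q.2.2 = f.2 ∧ q.1.2 + f.1 - q.2.1 ∈ V} := by
    refine ((measurable_snd.comp measurable_snd) (measurableSet_singleton f.2)).inter
      (hV.preimage ?_)
    fun_prop
  have hm := ProbabilityTheory.Kernel.measurable_kernel_prodMk_left
    (κ := ProbabilityTheory.Kernel.prodMkRight (Fin d → ℝ) (kernel d m)) hS
  exact (hm (measurableSet_singleton 0)).compl

/-- The positions of the occurrences of a pattern, as a measure on `ℝ^d`. -/
noncomputable def occMeasure (F : Set (ColSpace d m)) (V : Set (Fin d → ℝ))
    (ξ : PointMeasure d m) : Measure (Fin d → ℝ) :=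
  (ξ.toMeasure.restrict {z | Occurs F V ξ z.1}).map Prod.fst

theorem occMeasure_apply (ξ : PointMeasure d m) {A : Set (Fin d → ℝ)} (hA : MeasurableSet A) :
    occMeasure F V ξ A = ξ.toMeasure {z | z.1 ∈ A ∧ Occurs F V ξ z.1} := by
  rw [occMeasure, Measure.map_apply measurable_fst hA,
    Measure.restrict_apply (measurable_fst hA)]
  rfl

theorem measurableSet_occurs_left (hF : F.Finite) (hV : MeasurableSet V) (ξ : PointMeasure d m)
    {A : Set (Fin d → ℝ)} (hA : MeasurableSet A) :
    MeasurableSet {z : ColSpace d m | z.1 ∈ A ∧ Occurs F V ξ z.1} :=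
  (measurable_fst hA).inter
    ((measurableSet_occurs hF hV).preimage (measurable_const.prodMk measurable_fst))

theorem measurable_occMeasure (hF : F.Finite) (hV : MeasurableSet V) :
    Measurable (occMeasure F V) := by
  refine Measure.measurable_of_measurable_coe _ fun A hA => ?_
  simp_rw [occMeasure_apply _ hA]
  have hS : MeasurableSet {q : PointMeasure d m × ColSpace d m |
      q.2.1 ∈ A ∧ Occurs F V q.1 q.2.1} := by
    have h : Measurable fun q : PointMeasure d m × ColSpace d m => (q.1, q.2.1) := by fun_prop
    exact ((measurable_fst.comp measurable_snd) hA).inter (h (measurableSet_occurs hF hV))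
  exact ProbabilityTheory.Kernel.measurable_kernel_prodMk_left (κ := kernel d m) hS

theorem occMeasure_vadd (hF : F.Finite) (hV : MeasurableSet V) (t : Fin d → ℝ)
    (ξ : PointMeasure d m) {A : Set (Fin d → ℝ)} (hA : MeasurableSet A) :
    occMeasure F V (t +ᵥ ξ) A = occMeasure F V ξ ((fun x => t + x) ⁻¹' A) := by
  rw [occMeasure_apply _ hA, occMeasure_apply _ (hA.preimage (measurable_const_add t)),
    toMeasure_vadd, Measure.map_apply (measurable_shift t) (measurableSet_occurs_left hF hV _ hA)]
  congr 1
  ext z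
  exact and_congr Iff.rfl (occurs_vadd hV t ξ z.1)

theorem occMeasure_le {r : ℝ} (hr : 0 < r) {A : Set (Fin d → ℝ)} (hAm : MeasurableSet A)
    (hA : Bornology.IsBounded A) (F : Set (ColSpace d m)) (V : Set (Fin d → ℝ)) :
    ∃ k : ℕ, ∀ ξ ∈ hardCore d m r, occMeasure F V ξ A ≤ k := by
  obtain ⟨k, hk⟩ := exists_forall_measure_le (m := m) hr hA
  refine ⟨k, fun ξ hξ => ?_⟩
  rw [occMeasure_apply _ hAm]
  exact (measure_mono fun z hz => hz.1).trans (hk ξ hξ)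

theorem occMeasure_ne_top {r : ℝ} (hr : 0 < r) {ξ : PointMeasure d m} (hξ : ξ ∈ hardCore d m r)
    {A : Set (Fin d → ℝ)} (hAm : MeasurableSet A) (hA : Bornology.IsBounded A) :
    occMeasure F V ξ A ≠ ∞ := by
  obtain ⟨k, hk⟩ := occMeasure_le (m := m) hr hAm hA F V
  exact ne_top_of_le_ne_top (ENNReal.natCast_ne_top k) (hk ξ hξ)

theorem occMeasure_eq_encard (hF : F.Finite) (hV : MeasurableSet V) {r : ℝ} (hr : 0 < r)
    {ξ : PointMeasure d m} (hξ : ξ ∈ hardCore d m r) {A : Set (Fin d → ℝ)}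
    (hA : MeasurableSet A) :
    occMeasure F V ξ A = ({x ∈ flatten ξ.points | x ∈ A ∧ Occurs F V ξ x}.encard : ℝ≥0∞) := by
  rw [occMeasure_apply _ hA, measure_eq_encard hr hξ (measurableSet_occurs_left hF hV ξ hA)]
  have himg : {x ∈ flatten ξ.points | x ∈ A ∧ Occurs F V ξ x} =
      Prod.fst '' ({z | z.1 ∈ A ∧ Occurs F V ξ z.1} ∩ ξ.points) := by
    ext x
    constructor
    · rintro ⟨⟨z, hz, rfl⟩, h⟩
      exact ⟨z, ⟨h, hz⟩, rfl⟩
    · rintro ⟨z, ⟨h, hz⟩, rfl⟩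
      exact ⟨⟨z, hz, rfl⟩, h⟩
  rw [himg, ((injOn_fst_points hr hξ).mono inter_subset_right).encard_image]

/-! ### The Palm measure of a pattern -/

/-- Under the hard-core condition each position carries one point of mass `1`, so masses are counts.
That `-x + Λ` lies in the support is automatic, since the support is translation invariant. -/
theorem tsum_indicator_patternSet (hF : F.Finite) (hV : MeasurableSet V) {r : ℝ} (hr : 0 < r)
    {μ : Measure (PointMeasure d m)}
    [VAddInvariantMeasure (Fin d → ℝ) (PointMeasure d m) μ] {ξ : PointMeasure d m}
    (hξ : ξ ∈ hardCore d m r) (hξμ : ξ ∈ μ.support) {B : Set (Fin d → ℝ)}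
    (hB : MeasurableSet B) :
    ∑' x : ↥(B ∩ flatten ξ.points), (patternSet μ F V).indicator (fun _ => (1 : ℝ≥0∞))
      ((-(x : Fin d → ℝ)) +ᵥ ξ) = occMeasure F V ξ B := by
  classical
  rw [occMeasure_eq_encard hF hV hr hξ hB, ← ENNReal.tsum_set_one]
  rw [tsum_subtype (B ∩ flatten ξ.points)
    (fun x => (patternSet μ F V).indicator (fun _ => (1 : ℝ≥0∞)) ((-x) +ᵥ ξ)),
    tsum_subtype {x ∈ flatten ξ.points | x ∈ B ∧ Occurs F V ξ x} (fun _ => (1 : ℝ≥0∞))]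
  refine tsum_congr fun x => ?_
  have hmem : (-x) +ᵥ ξ ∈ patternSet μ F V ↔ Occurs F V ξ x := by
    rw [occurs_iff_subset_setShift hV]
    exact and_iff_right (vadd_mem_support (-x) hξμ)
  simp only [indicator_apply, hmem, mem_inter_iff, mem_ofPred_eq]
  by_cases h1 : x ∈ B <;> by_cases h2 : x ∈ flatten ξ.points <;>
    by_cases h3 : Occurs F V ξ x <;> simp [h1, h2, h3]

theorem ae_mem_hardCore {r : ℝ} {μ : Measure (PointMeasure d m)} (hμ : IsUDErgodicLaw r μ) :
    ∀ᵐ ξ ∂μ, ξ ∈ hardCore d m r :=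
  (ae_mem_support μ).mono fun _ h => hμ.support_subset h

theorem palm_patternSet_eq_lintegral (hF : F.Finite) (hV : MeasurableSet V) {r : ℝ}
    {μ : Measure (PointMeasure d m)} (hμ : IsUDErgodicLaw r μ) {B : Set (Fin d → ℝ)}
    (hB : MeasurableSet B) :
    palm μ B (patternSet μ F V) = (volume B)⁻¹ * ∫⁻ ξ, occMeasure F V ξ B ∂μ := by
  have := hμ.ergodic.toVAddInvariantMeasure
  rw [palm]
  congr 1
  refine lintegral_congr_ae ?_
  filter_upwards [ae_mem_support μ] with ξ hξ
  exact tsum_indicator_patternSet hF hV hμ.pos (hμ.support_subset hξ) hξ hB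

/-- The mean `ν` of the occurrence measure is translation invariant by stationarity and finite on
compact sets by the hard core, so it is a multiple of Lebesgue measure. Any window then gives the
same density. -/
theorem palm_patternSet_eq_of_volume_eq_one (hF : F.Finite) (hV : MeasurableSet V) {r : ℝ}
    {μ : Measure (PointMeasure d m)} (hμ : IsUDErgodicLaw r μ) {B Q : Set (Fin d → ℝ)}
    (hBm : MeasurableSet B) (hBb : Bornology.IsBounded B) (hB : volume B ≠ 0)
    (hQm : MeasurableSet Q) (hQ : volume Q = 1) :
    palm μ B (patternSet μ F V) = ∫⁻ ξ, occMeasure F V ξ Q ∂μ := by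
  have hinv := hμ.ergodic.toVAddInvariantMeasure
  have hprob := hμ.isProbabilityMeasure
  have hm := measurable_occMeasure hF hV
  set ν : Measure (Fin d → ℝ) := μ.bind (occMeasure F V) with hν
  have hνA : ∀ A, MeasurableSet A → ν A = ∫⁻ ξ, occMeasure F V ξ A ∂μ := fun A hA =>
    Measure.bind_apply hA hm.aemeasurable
  have h1 : ν.IsAddLeftInvariant := by
    refine ⟨fun t => ?_⟩
    ext A hA
    rw [Measure.map_apply (measurable_const_add t) hA, hνA _ (hA.preimage (measurable_const_add t)),
      hνA _ hA]
    simp_rw [← occMeasure_vadd hF hV t _ hA]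
    exact (measurePreserving_vadd t).lintegral_comp ((Measure.measurable_coe hA).comp hm)
  have h2 : IsFiniteMeasureOnCompacts ν := by
    refine ⟨fun K hK => ?_⟩
    obtain ⟨k, hk⟩ := occMeasure_le (m := m) hμ.pos hK.measurableSet hK.isBounded F V
    rw [hνA K hK.measurableSet]
    refine (lintegral_mono_ae ((ae_mem_hardCore hμ).mono hk)).trans_lt ?_
    simp
  have h3 := Measure.isAddLeftInvariant_eq_smul ν volume
  rw [palm_patternSet_eq_lintegral hF hV hμ hBm, ← hνA B hBm, ← hνA Q hQm, h3]
  simp only [Measure.smul_apply, hQ, smul_eq_mul, ENNReal.smul_def, mul_one]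
  rw [mul_comm, mul_assoc, ENNReal.mul_inv_cancel hB hBb.measure_lt_top.ne, mul_one]

end PointMeasure

/-! ### Cutting boxes into unit slabs -/

section Slabs

variable {X : Type*} [MeasurableSpace X]

theorem measure_slab_eq_sum (ν : Measure X) {Q : Set X} (hQ : MeasurableSet Q) {p : X → ℝ}
    (hp : Measurable p) (n : ℕ) :
    ν (Q ∩ {x | 0 ≤ p x ∧ p x < n}) =
      ∑ k ∈ Finset.range n, ν (Q ∩ {x | (k : ℝ) ≤ p x ∧ p x < k + 1}) := by
  have hm : ∀ a b : ℝ, MeasurableSet (Q ∩ {x | a ≤ p x ∧ p x < b}) := fun a b =>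
    hQ.inter (hp measurableSet_Ico)
  induction n with
  | zero =>
    have : {x | 0 ≤ p x ∧ p x < 0} = ∅ :=
      eq_empty_of_forall_notMem fun x hx => absurd hx.2 (not_lt.2 hx.1)
    simp [this]
  | succ n ih =>
    rw [Finset.sum_range_succ, ← ih, ← measure_union _ (hm _ _)]
    · congr 1
      ext x
      have hn : (0 : ℝ) ≤ n := Nat.cast_nonneg n
      simp only [mem_inter_iff, mem_union, mem_ofPred_eq, Nat.cast_add, Nat.cast_one]
      constructor
      · rintro ⟨hx, h1, h2⟩
        rcases lt_or_ge (p x) n with h | h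
        · exact Or.inl ⟨hx, h1, h⟩
        · exact Or.inr ⟨hx, h, h2⟩
      · rintro (⟨hx, h1, h2⟩ | ⟨hx, h1, h2⟩)
        · exact ⟨hx, h1, by linarith⟩
        · exact ⟨hx, by linarith, h2⟩
    · rw [disjoint_left]
      rintro x ⟨-, -, h1⟩ ⟨-, h2, -⟩
      exact absurd h1 (not_lt.2 h2)

theorem measure_neg_slab_eq_sum (ν : Measure X) {Q : Set X} (hQ : MeasurableSet Q) {p : X → ℝ}
    (hp : Measurable p) (n : ℕ) :
    ν (Q ∩ {x | -(n : ℝ) ≤ p x ∧ p x < 0}) =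
      ∑ k ∈ Finset.range n, ν (Q ∩ {x | -((k : ℝ) + 1) ≤ p x ∧ p x < -k}) := by
  have hm : ∀ a b : ℝ, MeasurableSet (Q ∩ {x | a ≤ p x ∧ p x < b}) := fun a b =>
    hQ.inter (hp measurableSet_Ico)
  induction n with
  | zero =>
    have : {x | 0 ≤ p x ∧ p x < 0} = ∅ :=
      eq_empty_of_forall_notMem fun x hx => absurd hx.2 (not_lt.2 hx.1)
    simp [this]
  | succ n ih =>
    rw [Finset.sum_range_succ, ← ih, ← measure_union _ (hm _ _)]
    · congr 1
      ext x
      have hn : (0 : ℝ) ≤ n := Nat.cast_nonneg n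
      simp only [mem_inter_iff, mem_union, mem_ofPred_eq, Nat.cast_add, Nat.cast_one]
      constructor
      · rintro ⟨hx, h1, h2⟩
        rcases lt_or_ge (p x) (-n) with h | h
        · exact Or.inr ⟨hx, h1, h⟩
        · exact Or.inl ⟨hx, h, h2⟩
      · rintro (⟨hx, h1, h2⟩ | ⟨hx, h1, h2⟩)
        · exact ⟨hx, by linarith, h2⟩
        · exact ⟨hx, h1, by linarith⟩
    · rw [disjoint_left]
      rintro x ⟨-, h1, -⟩ ⟨-, -, h2⟩
      exact absurd h2 (not_lt.2 h1)

end Slabs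

section Boxes

variable {d : ℕ}

/-- The box whose first `j` sides are `[-n, n)` and whose other sides are `[0, 1)`. -/
def mixedBox (d j n : ℕ) : Set (Fin d → ℝ) :=
  {x | ∀ i : Fin d, if (i : ℕ) < j then -(n : ℝ) ≤ x i ∧ x i < n else 0 ≤ x i ∧ x i < 1}

/-- The conditions of `mixedBox` on all coordinates but `i₀`. -/
def mixedBoxBase (d j n : ℕ) (i₀ : Fin d) : Set (Fin d → ℝ) :=
  {x | ∀ i : Fin d, i ≠ i₀ →
    if (i : ℕ) < j then -(n : ℝ) ≤ x i ∧ x i < n else 0 ≤ x i ∧ x i < 1}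

theorem measurableSet_side (d j n : ℕ) (i : Fin d) :
    MeasurableSet {x : Fin d → ℝ |
      if (i : ℕ) < j then -(n : ℝ) ≤ x i ∧ x i < n else 0 ≤ x i ∧ x i < 1} := by
  split_ifs
  · exact measurable_pi_apply i measurableSet_Ico
  · exact measurable_pi_apply i measurableSet_Ico

theorem measurableSet_mixedBox (d j n : ℕ) : MeasurableSet (mixedBox d j n) := by
  have : mixedBox d j n = ⋂ i : Fin d, {x : Fin d → ℝ |
      if (i : ℕ) < j then -(n : ℝ) ≤ x i ∧ x i < n else 0 ≤ x i ∧ x i < 1} := by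
    ext; simp [mixedBox]
  rw [this]
  exact MeasurableSet.iInter fun i => measurableSet_side d j n i

theorem measurableSet_mixedBoxBase (d j n : ℕ) (i₀ : Fin d) :
    MeasurableSet (mixedBoxBase d j n i₀) := by
  have : mixedBoxBase d j n i₀ = ⋂ (i : Fin d) (_ : i ≠ i₀), {x : Fin d → ℝ |
      if (i : ℕ) < j then -(n : ℝ) ≤ x i ∧ x i < n else 0 ≤ x i ∧ x i < 1} := by
    ext; simp [mixedBoxBase]
  rw [this]
  exact MeasurableSet.iInter fun i => MeasurableSet.iInter fun _ => measurableSet_side d j n i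

theorem isBounded_mixedBox (d j n : ℕ) : Bornology.IsBounded (mixedBox d j n) := by
  refine (Metric.isBounded_closedBall (x := (0 : Fin d → ℝ)) (r := n + 1)).subset fun x hx => ?_
  have hn : (0 : ℝ) ≤ n := Nat.cast_nonneg n
  rw [mem_closedBall_zero_iff, pi_norm_le_iff_of_nonneg (by positivity)]
  intro i
  have := hx i
  rw [Real.norm_eq_abs, abs_le]
  split_ifs at this
  · constructor <;> linarith [this.1, this.2]
  · constructor <;> linarith [this.1, this.2]

theorem volume_mixedBox_zero (d n : ℕ) : volume (mixedBox d 0 n) = 1 := by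
  have : mixedBox d 0 n = univ.pi fun _ : Fin d => Ico (0 : ℝ) 1 := by
    ext x; simp [mixedBox]
  rw [this, volume_pi_pi]
  simp

theorem mixedBox_succ_eq (j n : ℕ) (hj : j < d) :
    mixedBox d (j + 1) n =
      mixedBoxBase d j n ⟨j, hj⟩ ∩ {x | -(n : ℝ) ≤ x ⟨j, hj⟩ ∧ x ⟨j, hj⟩ < 0} ∪
        mixedBoxBase d j n ⟨j, hj⟩ ∩ {x | 0 ≤ x ⟨j, hj⟩ ∧ x ⟨j, hj⟩ < n} := by
  have hn : (0 : ℝ) ≤ n := Nat.cast_nonneg n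
  rw [← inter_union_distrib_left]
  ext x
  have hside : ∀ i : Fin d, i ≠ ⟨j, hj⟩ → ((i : ℕ) < j + 1 ↔ (i : ℕ) < j) := fun i hi => by
    have : (i : ℕ) ≠ j := fun h => hi (Fin.ext h)
    omega
  constructor
  · intro hx
    refine ⟨fun i hi => ?_, ?_⟩
    · have := hx i
      simpa only [hside i hi] using this
    · have := hx ⟨j, hj⟩
      rw [if_pos (by simp)] at this
      rcases lt_or_ge (x ⟨j, hj⟩) 0 with h | h
      · exact Or.inl ⟨this.1, h⟩
      · exact Or.inr ⟨h, this.2⟩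
  · rintro ⟨hx, hxj⟩ i
    by_cases hi : i = ⟨j, hj⟩
    · subst hi
      rw [if_pos (by simp)]
      rcases hxj with h | h
      · exact ⟨h.1, by linarith [h.2]⟩
      · exact ⟨by linarith [h.1], h.2⟩
    · simpa only [hside i hi] using hx i hi

theorem preimage_add_mixedBox (j n : ℕ) (hj : j < d) (c : ℝ) :
    (fun x : Fin d → ℝ => Pi.single ⟨j, hj⟩ c + x) ⁻¹' mixedBox d j n =
      mixedBoxBase d j n ⟨j, hj⟩ ∩ {x | -c ≤ x ⟨j, hj⟩ ∧ x ⟨j, hj⟩ < -c + 1} := by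
  ext x
  constructor
  · intro hx
    refine ⟨fun i hi => ?_, ?_⟩
    · have := hx i
      simpa [hi] using this
    · have := hx ⟨j, hj⟩
      simp only [Pi.add_apply, Pi.single_eq_same, lt_self_iff_false, if_false] at this
      exact ⟨by linarith [this.1], by linarith [this.2]⟩
  · rintro ⟨hx, hxj⟩ i
    by_cases hi : i = ⟨j, hj⟩
    · subst hi
      simp only [Pi.add_apply, Pi.single_eq_same, lt_self_iff_false, if_false]
      exact ⟨by linarith [hxj.1], by linarith [hxj.2]⟩
    · have := hx i hi
      simpa [hi] using this

theorem measure_mixedBox_succ (ν : Measure (Fin d → ℝ)) (j n : ℕ) (hj : j < d) :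
    ν (mixedBox d (j + 1) n) =
      ∑ k ∈ Finset.range n,
        ν ((fun x : Fin d → ℝ => Pi.single ⟨j, hj⟩ (-(k : ℝ)) + x) ⁻¹' mixedBox d j n) +
      ∑ k ∈ Finset.range n,
        ν ((fun x : Fin d → ℝ => Pi.single ⟨j, hj⟩ ((k : ℝ) + 1) + x) ⁻¹' mixedBox d j n) := by
  have hQ := measurableSet_mixedBoxBase d j n ⟨j, hj⟩
  have hp : Measurable fun x : Fin d → ℝ => x ⟨j, hj⟩ := measurable_pi_apply _
  have h1 := measure_slab_eq_sum ν hQ hp n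
  have h2 := measure_neg_slab_eq_sum ν hQ hp n
  rw [mixedBox_succ_eq j n hj, measure_union _ (hQ.inter ?_), h1, h2, add_comm]
  · simp only [preimage_add_mixedBox, neg_neg, neg_add_cancel_comm, neg_add_rev]
  · rw [disjoint_left]
    rintro x ⟨-, -, h1⟩ ⟨-, h2, -⟩
    exact absurd h1 (not_lt.2 h2)
  · exact hp measurableSet_Ico

end Boxes

/-! ### The multidimensional ergodic theorem, one coordinate at a time -/

namespace PointMeasure

variable {d m : ℕ} {F : Set (ColSpace d m)} {V : Set (Fin d → ℝ)}

theorem occMeasure_iterate_vadd (hF : F.Finite) (hV : MeasurableSet V) (i : Fin d) (c : ℝ)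
    (k : ℕ) (ξ : PointMeasure d m) {A : Set (Fin d → ℝ)} (hA : MeasurableSet A) :
    occMeasure F V ((fun ξ : PointMeasure d m => (Pi.single i c : Fin d → ℝ) +ᵥ ξ)^[k] ξ) A =
      occMeasure F V ξ ((fun x => (Pi.single i (k * c) : Fin d → ℝ) + x) ⁻¹' A) := by
  induction k generalizing A with
  | zero => simp
  | succ k ih =>
    rw [Function.iterate_succ_apply', occMeasure_vadd hF hV _ _ hA,
      ih (hA.preimage (measurable_const_add _)), ← preimage_comp]
    congr 2
    funext x
    simp only [Function.comp_apply, ← add_assoc, ← Pi.single_add]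
    congr 2
    push_cast
    ring

/-- The density of occurrences of a pattern in `mixedBox d j n`. -/
noncomputable def occAverage (F : Set (ColSpace d m)) (V : Set (Fin d → ℝ)) (j n : ℕ)
    (ξ : PointMeasure d m) : ℝ :=
  (occMeasure F V ξ (mixedBox d j n)).toReal / (2 * n) ^ j

theorem measurable_occAverage (hF : F.Finite) (hV : MeasurableSet V) (j n : ℕ) :
    Measurable (occAverage F V j n) :=
  (((Measure.measurable_coe (measurableSet_mixedBox d j n)).comp
    (measurable_occMeasure hF hV)).ennreal_toReal).div_const _

/-- The side `[-n, n)` splits into `2n` unit intervals. The slabs from `k` to `k + 1` come from `k`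
translations by `-1`; those from `-(k + 1)` to `-k` need `k + 1` translations by `1`, which is why
the second average starts at the translated configuration. -/
theorem occAverage_succ (hF : F.Finite) (hV : MeasurableSet V) {r : ℝ} (hr : 0 < r)
    {j : ℕ} (hj : j < d) (n : ℕ) {ξ : PointMeasure d m} (hξ : ξ ∈ hardCore d m r) :
    occAverage F V (j + 1) n ξ =
      (birkhoffAverage ℝ (fun ξ : PointMeasure d m => (Pi.single ⟨j, hj⟩ (-1) : Fin d → ℝ) +ᵥ ξ)
          (occAverage F V j n) n ξ +
        birkhoffAverage ℝ (fun ξ : PointMeasure d m => (Pi.single ⟨j, hj⟩ 1 : Fin d → ℝ) +ᵥ ξ)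
          (occAverage F V j n) n ((Pi.single ⟨j, hj⟩ 1 : Fin d → ℝ) +ᵥ ξ)) / 2 := by
  have hbox := measurableSet_mixedBox d j n
  have hfin := occMeasure_ne_top (F := F) (V := V) hr hξ (measurableSet_mixedBox d (j + 1) n)
    (isBounded_mixedBox d (j + 1) n)
  have hsum := measure_mixedBox_succ (occMeasure F V ξ) j n hj
  have h1 : ∀ k : ℕ, occMeasure F V ξ
      ((fun x : Fin d → ℝ => Pi.single ⟨j, hj⟩ (-(k : ℝ)) + x) ⁻¹' mixedBox d j n) =
      occMeasure F V ((fun ξ : PointMeasure d m =>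
        (Pi.single ⟨j, hj⟩ (-1) : Fin d → ℝ) +ᵥ ξ)^[k] ξ) (mixedBox d j n) := fun k => by
    rw [occMeasure_iterate_vadd hF hV _ _ _ _ hbox, mul_neg_one]
  have h2 : ∀ k : ℕ, occMeasure F V ξ
      ((fun x : Fin d → ℝ => Pi.single ⟨j, hj⟩ ((k : ℝ) + 1) + x) ⁻¹' mixedBox d j n) =
      occMeasure F V ((fun ξ : PointMeasure d m =>
        (Pi.single ⟨j, hj⟩ 1 : Fin d → ℝ) +ᵥ ξ)^[k]
          ((Pi.single ⟨j, hj⟩ 1 : Fin d → ℝ) +ᵥ ξ)) (mixedBox d j n) := fun k => by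
    have := occMeasure_iterate_vadd (F := F) hF hV (⟨j, hj⟩ : Fin d) 1 (k + 1) ξ hbox
    rw [Function.iterate_succ_apply] at this
    rw [this]
    simp
  simp_rw [h1, h2] at hsum
  rw [hsum] at hfin
  obtain ⟨hf1, hf2⟩ := ENNReal.add_ne_top.1 hfin
  rw [occAverage, hsum, ENNReal.toReal_add hf1 hf2,
    ENNReal.toReal_sum (ENNReal.sum_ne_top.1 hf1), ENNReal.toReal_sum (ENNReal.sum_ne_top.1 hf2)]
  simp only [birkhoffAverage, birkhoffSum, occAverage, smul_eq_mul, ← Finset.sum_div]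
  rcases n.eq_zero_or_pos with rfl | hn
  · simp
  · have : (0 : ℝ) < n := by exact_mod_cast hn
    field_simp
    ring

/-- The bound is carried along with the convergence because the ergodic theorem for varying
functions needs both at the next coordinate. -/
theorem exists_ae_tendsto_occAverage (hF : F.Finite) (hV : MeasurableSet V) {r : ℝ}
    {μ : Measure (PointMeasure d m)} (hμ : IsUDErgodicLaw r μ) {j : ℕ} (hj : j ≤ d) :
    (∃ C, 0 ≤ C ∧ ∀ n, ∀ᵐ ξ ∂μ, |occAverage F V j n ξ| ≤ C) ∧
      ∃ g : PointMeasure d m → ℝ, Measurable g ∧ Integrable g μ ∧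
        ∫ ξ, g ξ ∂μ = ∫ ξ, (occMeasure F V ξ (mixedBox d 0 0)).toReal ∂μ ∧
        ∀ᵐ ξ ∂μ, Tendsto (fun n => occAverage F V j n ξ) atTop (𝓝 (g ξ)) := by
  have hinv := hμ.ergodic.toVAddInvariantMeasure
  have hprob := hμ.isProbabilityMeasure
  induction j with
  | zero =>
    have hbox : ∀ n, mixedBox d 0 n = mixedBox d 0 0 := fun n => by ext; simp [mixedBox]
    obtain ⟨k, hk⟩ := occMeasure_le (m := m) hμ.pos (measurableSet_mixedBox d 0 0)
      (isBounded_mixedBox d 0 0) F V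
    have hb : ∀ᵐ ξ ∂μ, |(occMeasure F V ξ (mixedBox d 0 0)).toReal| ≤ k := by
      filter_upwards [ae_mem_hardCore hμ] with ξ hξ
      rw [abs_of_nonneg ENNReal.toReal_nonneg]
      exact ENNReal.toReal_le_of_le_ofReal (Nat.cast_nonneg k) (by simpa using hk ξ hξ)
    have hm : Measurable fun ξ => (occMeasure F V ξ (mixedBox d 0 0)).toReal :=
      ((Measure.measurable_coe (measurableSet_mixedBox d 0 0)).comp
        (measurable_occMeasure hF hV)).ennreal_toReal
    simp only [occAverage, pow_zero, div_one, hbox]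
    exact ⟨⟨k, Nat.cast_nonneg k, fun _ => hb⟩, _, hm,
      Integrable.of_bound hm.aestronglyMeasurable k hb, rfl,
      Eventually.of_forall fun ξ => tendsto_const_nhds⟩
  | succ j ih =>
    have hj' : j < d := hj
    obtain ⟨⟨C, hC0, hC⟩, g, hgm, hgi, hgint, hglim⟩ := ih hj'.le
    set T : PointMeasure d m → PointMeasure d m :=
      fun ξ => (Pi.single ⟨j, hj'⟩ (-1) : Fin d → ℝ) +ᵥ ξ with hT
    set T' : PointMeasure d m → PointMeasure d m :=
      fun ξ => (Pi.single ⟨j, hj'⟩ 1 : Fin d → ℝ) +ᵥ ξ with hT'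
    have hTp : MeasurePreserving T μ μ := measurePreserving_vadd _
    have hTp' : MeasurePreserving T' μ μ := measurePreserving_vadd _
    have hGm := fun n => measurable_occAverage hF hV (d := d) j n
    have hsucc : ∀ᵐ ξ ∂μ, ∀ n, occAverage F V (j + 1) n ξ =
        (birkhoffAverage ℝ T (occAverage F V j n) n ξ +
          birkhoffAverage ℝ T' (occAverage F V j n) n (T' ξ)) / 2 := by
      filter_upwards [ae_mem_hardCore hμ] with ξ hξ n
      exact occAverage_succ hF hV hμ.pos hj' n hξ
    have hCT : ∀ n, ∀ᵐ ξ ∂μ, |birkhoffAverage ℝ T (occAverage F V j n) n ξ| ≤ C := fun n => by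
      filter_upwards [ae_all_iff.2 fun k => (hTp.iterate k).quasiMeasurePreserving.ae (hC n)]
        with ξ hξ
      exact abs_birkhoffAverage_le hC0 hξ n
    have hCT' : ∀ n, ∀ᵐ ξ ∂μ, |birkhoffAverage ℝ T' (occAverage F V j n) n ξ| ≤ C := fun n => by
      filter_upwards [ae_all_iff.2 fun k => (hTp'.iterate k).quasiMeasurePreserving.ae (hC n)]
        with ξ hξ
      exact abs_birkhoffAverage_le hC0 hξ n
    obtain ⟨g₁, hg₁m, hg₁i, hg₁int, hg₁⟩ :=
      exists_ae_tendsto_birkhoffAverage_of_tendsto hTp hGm hgm hC hglim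
    obtain ⟨g₂, hg₂m, hg₂i, hg₂int, hg₂⟩ :=
      exists_ae_tendsto_birkhoffAverage_of_tendsto hTp' hGm hgm hC hglim
    have hg₂T : Integrable (fun ξ => g₂ (T' ξ)) μ := hTp'.integrable_comp_of_integrable hg₂i
    have hg₂Tint : ∫ ξ, g₂ (T' ξ) ∂μ = ∫ ξ, g₂ ξ ∂μ := by
      conv_rhs => rw [← hTp'.map_eq]
      rw [integral_map hTp'.aemeasurable]
      exact hg₂m.aestronglyMeasurable
    refine ⟨⟨C, hC0, fun n => ?_⟩, fun ξ => (g₁ ξ + g₂ (T' ξ)) / 2,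
      (hg₁m.add (hg₂m.comp hTp'.measurable)).div_const 2, (hg₁i.add hg₂T).div_const 2, ?_, ?_⟩
    · filter_upwards [hsucc, hCT n, hTp'.quasiMeasurePreserving.ae (hCT' n)] with ξ h1 h2 h3
      rw [h1 n]
      rw [abs_le] at *
      constructor <;> linarith [h2.1, h2.2, h3.1, h3.2]
    · rw [integral_div, integral_add hg₁i hg₂T, hg₂Tint, hg₁int, hg₂int, hgint]
      ring
    · filter_upwards [hsucc, hg₁, hTp'.quasiMeasurePreserving.ae hg₂] with ξ h1 h2 h3
      simp_rw [h1]
      exact (h2.add h3).div_const 2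

end PointMeasure

/-! ### Comparing boxes of asymptotically equal side length -/

section Averages

/-- This serves twice: for boxes enlarged or shrunk by a fixed amount, and for passing from integer
half-sides to a real edge length `R`. -/
theorem tendsto_div_pow_of_tendsto_div_two_mul_pow {ι : Type*} {l : Filter ι} {u : ℕ → ℝ} {L : ℝ}
    {d : ℕ} (hu : Tendsto (fun n : ℕ => u n / (2 * n) ^ d) atTop (𝓝 L)) {n : ι → ℕ} {ρ : ι → ℝ}
    (hn : Tendsto n l atTop) (hρ : Tendsto (fun i => 2 * (n i : ℝ) / ρ i) l (𝓝 1)) :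
    Tendsto (fun i => u (n i) / ρ i ^ d) l (𝓝 L) := by
  have h := (hu.comp hn).mul (hρ.pow d)
  rw [one_pow, mul_one] at h
  refine h.congr' ?_
  filter_upwards [hn.eventually_ge_atTop 1] with i hi
  have : (0 : ℝ) < n i := by exact_mod_cast hi
  simp only [Function.comp_apply, div_pow]
  field_simp

theorem tendsto_two_mul_div_of_eventually_eq {n : ℝ → ℕ} {c : ℝ}
    (h : ∀ᶠ R : ℝ in atTop, (n R : ℝ) = ⌊R / 2⌋₊ + c) :
    Tendsto (fun R => 2 * (n R : ℝ) / R) atTop (𝓝 1) := by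
  have h1 : Tendsto (fun R : ℝ => (⌊R / 2⌋₊ : ℝ) / (R / 2)) atTop (𝓝 1) :=
    (tendsto_nat_floor_div_atTop (R := ℝ)).comp (tendsto_id.atTop_div_const two_pos)
  have h2 : Tendsto (fun R : ℝ => 2 * c / R) atTop (𝓝 0) := tendsto_id.const_div_atTop _
  have h3 := h1.add h2
  rw [add_zero] at h3
  refine h3.congr' ?_
  filter_upwards [h, eventually_gt_atTop 0] with R hR hR0
  rw [hR]
  field_simp

theorem tendsto_two_mul_natCast_add_div (k : ℕ) :
    Tendsto (fun n : ℕ => 2 * ((n + k : ℕ) : ℝ) / (2 * n)) atTop (𝓝 1) := by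
  have h1 : Tendsto (fun n : ℕ => 1 + (k : ℝ) / n) atTop (𝓝 (1 + 0)) :=
    tendsto_const_nhds.add (tendsto_natCast_atTop_atTop.const_div_atTop _)
  rw [add_zero] at h1
  refine h1.congr' ?_
  filter_upwards [eventually_ge_atTop 1] with n hn
  have : (0 : ℝ) < n := by exact_mod_cast hn
  push_cast
  field_simp

theorem tendsto_two_mul_natCast_sub_div (k : ℕ) :
    Tendsto (fun n : ℕ => 2 * ((n - k : ℕ) : ℝ) / (2 * n)) atTop (𝓝 1) := by
  have h1 : Tendsto (fun n : ℕ => 1 - (k : ℝ) / n) atTop (𝓝 (1 - 0)) :=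
    tendsto_const_nhds.sub (tendsto_natCast_atTop_atTop.const_div_atTop _)
  rw [sub_zero] at h1
  refine h1.congr' ?_
  filter_upwards [eventually_ge_atTop 1, eventually_ge_atTop k] with n hn hk
  have : (0 : ℝ) < n := by exact_mod_cast hn
  rw [Nat.cast_sub hk]
  field_simp

end Averages

/-- The exceptional null set may depend on `t`. Every measurable preimage under `g` is still null or
conull, and countably many measurable sets separate the points of `ℝ`. -/
theorem ErgodicVAdd.exists_ae_eq_const {G α : Type*} [VAdd G α] [MeasurableSpace α]
    {μ : Measure α} [ErgodicVAdd G α μ] {g : α → ℝ} (hg : Measurable g)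
    (hinv : ∀ t : G, ∀ᵐ x ∂μ, g (t +ᵥ x) = g x) : ∃ c, ∀ᵐ x ∂μ, g x = c := by
  refine exists_eventuallyEq_const_of_forall_separating MeasurableSet fun U hU => ?_
  have h := ErgodicVAdd.aeconst_of_forall_preimage_vadd_ae_eq (G := G) (μ := μ) (hg hU)
    fun t => by
      filter_upwards [hinv t] with x hx
      have : (t +ᵥ x ∈ g ⁻¹' U) = (x ∈ g ⁻¹' U) := by simp only [mem_preimage, hx]
      exact this
  exact eventuallyConst_set.1 h

section Cubes

variable {d : ℕ}

theorem mem_mixedBox_self {n : ℕ} {x : Fin d → ℝ} :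
    x ∈ mixedBox d d n ↔ ∀ i, -(n : ℝ) ≤ x i ∧ x i < n := by
  simp [mixedBox]

theorem volume_openCube {R : ℝ} (hR : 0 ≤ R) :
    volume (openCube d R) = ENNReal.ofReal (R ^ d) := by
  have : openCube d R = univ.pi fun _ : Fin d => Ioo (-(R / 2)) (R / 2) := by
    ext x; simp [openCube, abs_lt]
  rw [this, volume_pi_pi]
  simp [ENNReal.ofReal_pow hR]

theorem openCube_subset_mixedBox (R : ℝ) : openCube d R ⊆ mixedBox d d (⌊R / 2⌋₊ + 1) := by
  intro x hx
  rw [mem_mixedBox_self]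
  intro i
  have h1 := abs_lt.1 (hx i)
  have h2 := Nat.lt_floor_add_one (R / 2)
  push_cast
  constructor <;> linarith [h1.1, h1.2]

theorem preimage_add_subset_mixedBox {t : Fin d → ℝ} {k : ℕ} (hk : ‖t‖ ≤ k) (n : ℕ) :
    (fun x => t + x) ⁻¹' mixedBox d d n ⊆ mixedBox d d (n + k) := by
  intro x hx
  rw [mem_preimage, mem_mixedBox_self] at hx
  rw [mem_mixedBox_self]
  intro i
  have h1 := abs_le.1 ((norm_le_pi_norm t i).trans hk)
  have h2 := hx i
  simp only [Pi.add_apply] at h2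
  push_cast
  constructor <;> linarith [h1.1, h1.2, h2.1, h2.2]

theorem mixedBox_subset_preimage_add {t : Fin d → ℝ} {k : ℕ} (hk : ‖t‖ ≤ k) {n : ℕ}
    (hkn : k ≤ n) : mixedBox d d (n - k) ⊆ (fun x => t + x) ⁻¹' mixedBox d d n := by
  intro x hx
  rw [mem_mixedBox_self] at hx
  rw [mem_preimage, mem_mixedBox_self]
  intro i
  have h1 := abs_le.1 ((norm_le_pi_norm t i).trans hk)
  have h2 := hx i
  rw [Nat.cast_sub hkn] at h2
  simp only [Pi.add_apply]
  constructor <;> linarith [h1.1, h1.2, h2.1, h2.2]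

end Cubes

/-! ### Identification of the limit and passage to the cubes `C_R` -/

namespace PointMeasure

variable {d m : ℕ} {F : Set (ColSpace d m)} {V : Set (Fin d → ℝ)}

/-- A box translated by `t` lies between the boxes with half-sides `n - k` and `n + k`, where `k ≥
‖t‖`; this makes the limit translation invariant. -/
theorem tendsto_occAverage_vadd (hF : F.Finite) (hV : MeasurableSet V) {r : ℝ} (hr : 0 < r)
    {ξ : PointMeasure d m} (hξ : ξ ∈ hardCore d m r) (t : Fin d → ℝ) {L : ℝ}
    (hL : Tendsto (fun n => occAverage F V d n ξ) atTop (𝓝 L)) :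
    Tendsto (fun n => occAverage F V d n (t +ᵥ ξ)) atTop (𝓝 L) := by
  obtain ⟨k, hk⟩ := exists_nat_ge ‖t‖
  have hfin : ∀ n, occMeasure F V ξ (mixedBox d d n) ≠ ∞ := fun n =>
    occMeasure_ne_top hr hξ (measurableSet_mixedBox d d n) (isBounded_mixedBox d d n)
  have hup := tendsto_div_pow_of_tendsto_div_two_mul_pow hL (tendsto_add_atTop_nat k)
    (tendsto_two_mul_natCast_add_div k)
  have hlow := tendsto_div_pow_of_tendsto_div_two_mul_pow hL (tendsto_sub_atTop_nat k)
    (tendsto_two_mul_natCast_sub_div k)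
  have hshift : ∀ n, occMeasure F V (t +ᵥ ξ) (mixedBox d d n) =
      occMeasure F V ξ ((fun x => t + x) ⁻¹' mixedBox d d n) := fun n =>
    occMeasure_vadd hF hV t ξ (measurableSet_mixedBox d d n)
  have hle : ∀ n, occMeasure F V (t +ᵥ ξ) (mixedBox d d n) ≤
      occMeasure F V ξ (mixedBox d d (n + k)) := fun n => by
    rw [hshift]
    exact measure_mono (preimage_add_subset_mixedBox hk n)
  refine tendsto_of_tendsto_of_tendsto_of_le_of_le' hlow hup ?_ ?_
  · filter_upwards [eventually_ge_atTop k] with n hn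
    refine div_le_div_of_nonneg_right ?_ (by positivity)
    refine ENNReal.toReal_mono (ne_top_of_le_ne_top (hfin _) (hle n)) ?_
    rw [hshift]
    exact measure_mono (mixedBox_subset_preimage_add hk hn)
  · refine Eventually.of_forall fun n => div_le_div_of_nonneg_right ?_ (by positivity)
    exact ENNReal.toReal_mono (hfin _) (hle n)

theorem exists_ae_tendsto_occAverage_const (hF : F.Finite) (hV : MeasurableSet V) {r : ℝ}
    {μ : Measure (PointMeasure d m)} (hμ : IsUDErgodicLaw r μ) :
    ∀ᵐ ξ ∂μ, Tendsto (fun n => occAverage F V d n ξ) atTop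
      (𝓝 (∫ ξ, (occMeasure F V ξ (mixedBox d 0 0)).toReal ∂μ)) := by
  have herg := hμ.ergodic
  have hprob := hμ.isProbabilityMeasure
  obtain ⟨-, g, hgm, hgi, hgint, hg⟩ := exists_ae_tendsto_occAverage hF hV hμ le_rfl
  have hinv : ∀ t : Fin d → ℝ, ∀ᵐ ξ ∂μ, g (t +ᵥ ξ) = g ξ := fun t => by
    filter_upwards [ae_mem_hardCore hμ, hg,
      (measurePreserving_vadd (μ := μ) t).quasiMeasurePreserving.ae hg] with ξ h1 h2 h3
    exact tendsto_nhds_unique h3 (tendsto_occAverage_vadd hF hV hμ.pos h1 t h2)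
  obtain ⟨c, hc⟩ := ErgodicVAdd.exists_ae_eq_const (G := Fin d → ℝ) hgm hinv
  have hcint : ∫ ξ, g ξ ∂μ = c := by
    rw [integral_congr_ae hc]
    simp
  rw [← hgint, hcint]
  filter_upwards [hg, hc] with ξ h1 h2
  rwa [← h2]

theorem palm_patternSet_eq_ofReal (hF : F.Finite) (hV : MeasurableSet V) {r : ℝ}
    {μ : Measure (PointMeasure d m)} (hμ : IsUDErgodicLaw r μ) {B : Set (Fin d → ℝ)}
    (hBm : MeasurableSet B) (hBb : Bornology.IsBounded B) (hB : volume B ≠ 0) :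
    palm μ B (patternSet μ F V) =
      ENNReal.ofReal (∫ ξ, (occMeasure F V ξ (mixedBox d 0 0)).toReal ∂μ) := by
  have hprob := hμ.isProbabilityMeasure
  have hQ := measurableSet_mixedBox d 0 0
  rw [palm_patternSet_eq_of_volume_eq_one hF hV hμ hBm hBb hB hQ (volume_mixedBox_zero d 0)]
  obtain ⟨k, hk⟩ := occMeasure_le (m := m) hμ.pos hQ (isBounded_mixedBox d 0 0) F V
  have hk' : ∀ᵐ ξ ∂μ, occMeasure F V ξ (mixedBox d 0 0) ≤ k := (ae_mem_hardCore hμ).mono hk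
  have hm : Measurable fun ξ => occMeasure F V ξ (mixedBox d 0 0) :=
    (Measure.measurable_coe hQ).comp (measurable_occMeasure hF hV)
  rw [integral_toReal hm.aemeasurable
    (hk'.mono fun ξ h => h.trans_lt (ENNReal.natCast_lt_top k)), ENNReal.ofReal_toReal]
  refine ne_top_of_le_ne_top (b := ∫⁻ _, (k : ℝ≥0∞) ∂μ) (by simp) (lintegral_mono_ae hk')

theorem patternCount_le {s : ℝ} (hFV : IsPattern s F V) {r : ℝ} (hr : 0 < r) {ξ : PointMeasure d m}
    (hξ : ξ ∈ hardCore d m r) (R : ℝ) :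
    (patternCount F V ξ.points (openCube d R) : ℝ≥0∞) ≤
      occMeasure F V ξ (mixedBox d d (⌊R / 2⌋₊ + 1)) := by
  rw [occMeasure_eq_encard hFV.finite hFV.measurable hr hξ (measurableSet_mixedBox _ _ _)]
  refine ENat.toENNReal_le.2 (encard_le_encard ?_)
  rintro x ⟨hx, hocc, hin⟩
  refine ⟨hx, openCube_subset_mixedBox R ?_, (occurs_iff_subset_image hFV.measurable ξ x).2 hocc⟩
  -- Since `0` lies in `V` and in the flattened `F`, the containment condition puts `x` itself in
  -- `C_R`.
  simpa using hin 0 (mem_of_mem_nhds hFV.nhds_zero) 0 hFV.zero_mem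

theorem exists_forall_le_patternCount {s : ℝ} (hFV : IsPattern s F V) :
    ∃ k : ℕ, ∀ {r : ℝ}, 0 < r →
    ∀ ξ ∈ hardCore d m r, ∀ R : ℝ, k ≤ ⌊R / 2⌋₊ →
      occMeasure F V ξ (mixedBox d d (⌊R / 2⌋₊ - k)) ≤
        patternCount F V ξ.points (openCube d R) := by
  obtain ⟨K₁, hK₁⟩ := hFV.bounded.exists_norm_le
  obtain ⟨K₂, hK₂⟩ := (hFV.finite.image Prod.fst).isBounded.exists_norm_le
  -- Exceeding `K₁ + K₂` strictly keeps `x - v + f` inside the open cube; positivity of `k` rules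
  -- out negative `R`, whose floor would be `0`.
  obtain ⟨k, hk⟩ := exists_nat_gt (max 0 (K₁ + K₂))
  refine ⟨k, fun {r} hr ξ hξ R hR => ?_⟩
  rw [occMeasure_eq_encard hFV.finite hFV.measurable hr hξ (measurableSet_mixedBox _ _ _)]
  refine ENat.toENNReal_le.2 (encard_le_encard ?_)
  rintro x ⟨hx, hbox, hocc⟩
  refine ⟨hx, (occurs_iff_subset_image hFV.measurable ξ x).1 hocc, fun v hv f hf i => ?_⟩
  have h1 := mem_mixedBox_self.1 hbox i
  rw [Nat.cast_sub hR] at h1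
  have hk0 : (0 : ℝ) < k := (le_max_left _ _).trans_lt hk
  have hk1 : K₁ + K₂ < k := (le_max_right _ _).trans_lt hk
  have hR0 : 0 ≤ R / 2 := by
    by_contra hneg
    rw [Nat.floor_of_nonpos (not_le.1 hneg).le, Nat.le_zero] at hR
    rw [hR] at hk0
    simp at hk0
  have h2 := Nat.floor_le hR0
  have h3 := abs_le.1 ((norm_le_pi_norm v i).trans (hK₁ v hv))
  have h4 := abs_le.1 ((norm_le_pi_norm f i).trans (hK₂ f hf))
  simp only [Pi.add_apply, Pi.sub_apply]
  rw [abs_lt]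
  constructor <;> linarith [h1.1, h1.2, h3.1, h3.2, h4.1, h4.2]

/-- Almost surely, the density of a pattern is a limit, equal to its Palm measure. -/
theorem ae_tendsto_patternDensity {r : ℝ} {μ : Measure (PointMeasure d m)}
    (hμ : IsUDErgodicLaw r μ) (hFV : IsPattern r F V) {B : Set (Fin d → ℝ)}
    (hBm : MeasurableSet B) (hBb : Bornology.IsBounded B) (hB : volume B ≠ 0) :
    ∀ᵐ ξ ∂μ, Tendsto (fun R : ℝ => patternDensity F V ξ.points R) atTop
      (𝓝 (palm μ B (patternSet μ F V))) := by
  rw [palm_patternSet_eq_ofReal hFV.finite hFV.measurable hμ hBm hBb hB]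
  obtain ⟨k, hk⟩ := exists_forall_le_patternCount hFV
  have hfloor : Tendsto (fun R : ℝ => ⌊R / 2⌋₊) atTop atTop :=
    tendsto_nat_floor_atTop.comp (tendsto_id.atTop_div_const two_pos)
  filter_upwards [ae_mem_hardCore hμ,
    exists_ae_tendsto_occAverage_const hFV.finite hFV.measurable hμ] with ξ hξ hlim
  have hdiv : ∀ n, ∀ R > 0, ENNReal.ofReal ((occMeasure F V ξ (mixedBox d d n)).toReal / R ^ d) =
      occMeasure F V ξ (mixedBox d d n) / volume (openCube d R) := fun n R hR => by
    rw [ENNReal.ofReal_div_of_pos (by positivity), volume_openCube hR.le, ENNReal.ofReal_toReal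
      (occMeasure_ne_top hμ.pos hξ (measurableSet_mixedBox _ _ _) (isBounded_mixedBox _ _ _))]
  have hup := tendsto_div_pow_of_tendsto_div_two_mul_pow hlim
    ((tendsto_add_atTop_nat 1).comp hfloor)
    (tendsto_two_mul_div_of_eventually_eq (c := 1) (Eventually.of_forall fun R => by simp))
  have hlow := tendsto_div_pow_of_tendsto_div_two_mul_pow hlim
    ((tendsto_sub_atTop_nat k).comp hfloor)
    (tendsto_two_mul_div_of_eventually_eq (c := -k) (by
      filter_upwards [hfloor.eventually_ge_atTop k] with R hR
      simp [Nat.cast_sub hR, sub_eq_add_neg]))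
  refine tendsto_of_tendsto_of_tendsto_of_le_of_le' (ENNReal.tendsto_ofReal hlow)
    (ENNReal.tendsto_ofReal hup) ?_ ?_
  · filter_upwards [hfloor.eventually_ge_atTop k, eventually_gt_atTop 0] with R hR hR0
    rw [hdiv _ R hR0]
    exact ENNReal.div_le_div_right (hk hμ.pos ξ hξ R hR) _
  · filter_upwards [eventually_gt_atTop 0] with R hR0
    rw [hdiv _ R hR0]
    exact ENNReal.div_le_div_right (patternCount_le hFV hμ.pos hξ R) _

end PointMeasure

theorem proposition11p1 {d m : ℕ} (r : ℝ) (μ : Measure (PointMeasure d m))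
    (hμ : IsUDErgodicLaw r μ) (F : Set (ColSpace d m)) (V : Set (Fin d → ℝ))
    (hFV : IsPattern r F V)
    (B : Set (Fin d → ℝ)) (hBm : MeasurableSet B) (hBb : Bornology.IsBounded B)
    (hB : volume B ≠ 0) :
    (IsOpen V → ∀ᵐ ξ ∂μ, lowerFreq F V ξ.points = palm μ B (patternSet μ F V)) ∧
    (IsClosed V → ∀ᵐ ξ ∂μ, upperFreq F V ξ.points = palm μ B (patternSet μ F V)) := by
  have h := PointMeasure.ae_tendsto_patternDensity hμ hFV hBm hBb hB
  exact ⟨fun _ => h.mono fun ξ hξ => hξ.liminf_eq, fun _ => h.mono fun ξ hξ => hξ.limsup_eq⟩
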